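/- Let $n$ be a positive integer, $\lambda\in\mathbb R\setminus\{0\}$ and $1\le p,q\le\infty$. Write points of $\mathbb R^{2n}$ as $\xi=(x,u)$ with $x,u\in\mathbb R^n$, and let $[(x,u),(y,v)]=u\cdot y-v\cdot x$. For $g\in\mathcal S(\mathbb R^{2n})$ and $\xi,\eta\in\mathbb R^{2n}$, $\eta=(a,b)$, define the twisted translation, the twisted modulation and the operator $\Pi_\lambda(\xi,\eta)$ by $$\tau_\lambda(\xi)g(X)=g(X-\xi)\,e^{-i\frac{\lambda}{2}[X,\xi]},$$ $$e_\lambda(a,b)g(x,u)=g\big(x-(\tanh\tfrac{\lambda}{2})b,\;u+(\tanh\tfrac{\lambda}{2})a\big)\,e^{-i\frac{\lambda}{2}(\coth\frac{\lambda}{2})(x\cdot a+u\cdot b)},$$ $$\Pi_\lambda(\xi,\eta)=e^{i\frac{\lambda}{2}(\coth\lambda)\,\xi\cdot\eta}\,e_\lambda(\eta)\,\tau_\lambda(\xi).$$ For a tempered distribution $f$ on $\mathbb R^{2n}$ and $g\in\mathcal S(\mathbb R^{2n})$ let $\langle f,g\rangle=f(\overline g)$ and $$\|f\|_{(p,q),g}=\Big(\int_{\mathbb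 R^{2n}}\Big(\int_{\mathbb R^{2n}}|\langle f,\Pi_\lambda(\xi,\eta)g\rangle|^p\,d\xi\Big)^{q/p}d\eta\Big)^{1/q},$$ with essential suprema when $p$ or $q$ is infinite. Thus $\|f\|_{(p,q),g}<\infty$ means that $(\xi,\eta)\mapsto\langle f,\Pi_\lambda(\xi,\eta)g\rangle$ belongs to the mixed norm space $L^{p,q}(\mathbb R^{2n}\times\mathbb R^{2n})$. The twisted modulation space $M_\lambda^{p,q}(\mathbb R^{2n})$ is the set of tempered distributions $f$ on $\mathbb R^{2n}$ for which this holds for some nonzero $g\in\mathcal S(\mathbb R^{2n})$. Theorem. The definition of $M_\lambda^{p,q}(\mathbb R^{2n})$ is independent of the window $g$: if $\langle f,\Pi_\lambda(\xi,\eta)g\rangle$ belongs to $L^{p,q}(\mathbb R^{2n}\times\mathbb R^{2n})$ for some nonzero $g\in\mathcal S(\mathbb R^{2n})$, then $\langle f,\Pi_\lambda(\xi,\eta)g'\rangle$ belongs to $L^{p,q}(\mathbb R^{2n}\times\mathbb R^{2n})$ for every $g'\in\mathcal S(\mathbb R^{2n})$. Consequently, for every nonzero $g\in\mathcal S(\mathbb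 R^{2n})$, $M_\lambda^{p,q}(\mathbb R^{2n})=\{f:\|f\|_{(p,q),g}<\infty\}$. This is a vector space on which each $\|\cdot\|_{(p,q),g}$ with $g\neq0$ is a norm, and different nonzero windows define equivalent norms: for all nonzero $g,g'\in\mathcal S(\mathbb R^{2n})$ there are constants $c,C>0$ such that $$c\,\|f\|_{(p,q),g}\le\|f\|_{(p,q),g'}\le C\,\|f\|_{(p,q),g}\qquad\text{for all } f\in M_\lambda^{p,q}(\mathbb R^{2n}).$$ -/

import Mathlib

open MeasureTheory
open scoped SchwartzMap ENNReal NNReal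

noncomputable section

namespace TwistedModulation

/-- The space `ℝ^{2n}`, with points `ξ = (x, u)`: the coordinates of `x` are indexed by
`Sum.inl i`, those of `u` by `Sum.inr i`. -/
abbrev R2 (n : ℕ) : Type := EuclideanSpace ℝ (Fin n ⊕ Fin n)

/-- The hyperbolic cotangent. -/
def coth (t : ℝ) : ℝ := Real.cosh t / Real.sinh t

/-- The symplectic form `[(x, u), (y, v)] = u ⬝ y - v ⬝ x` on `ℝ^{2n}`. -/
def symp {n : ℕ} (ξ η : R2 n) : ℝ :=
  ∑ i, (ξ (Sum.inr i) * η (Sum.inl i) - η (Sum.inr i) * ξ (Sum.inl i))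

/-- The map `(a, b) ↦ (b, -a)` on `ℝ^{2n}`. -/
def rotJ {n : ℕ} (η : R2 n) : R2 n :=
  WithLp.toLp 2 (Sum.elim (fun i => η (Sum.inr i)) (fun i => -η (Sum.inl i)))

/-- The phase of the `λ`-twisted translation by `ξ`. -/
def translationPhase {n : ℕ} (lam : ℝ) (ξ : R2 n) (X : R2 n) : ℂ :=
  Complex.exp (Complex.I * ((-(lam / 2) * symp X ξ : ℝ) : ℂ))

/-- The phase of the `λ`-twisted modulation by `η`. -/
def modulationPhase {n : ℕ} (lam : ℝ) (η : R2 n) (X : R2 n) : ℂ :=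
  Complex.exp (Complex.I * ((-(lam / 2) * coth (lam / 2) * inner ℝ X η : ℝ) : ℂ))

/-- The `λ`-twisted translation on Schwartz functions:
`τ_λ(ξ) g (X) = g (X - ξ) e^{-i (λ/2) [X, ξ]}` (see `twistedTranslation_apply`). -/
def twistedTranslation {n : ℕ} (lam : ℝ) (ξ : R2 n) : 𝓢(R2 n, ℂ) →L[ℂ] 𝓢(R2 n, ℂ) :=
  (SchwartzMap.smulLeftCLM ℂ (translationPhase lam ξ)).comp (SchwartzMap.compSubConstCLM ℂ ξ)

/-- The `λ`-twisted modulation on Schwartz functions: for `η = (a, b)`,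
`e_λ(a, b) g (x, u) = g (x - tanh(λ/2) b, u + tanh(λ/2) a) e^{-i (λ/2) coth(λ/2) (x ⬝ a + u ⬝ b)}`
(see `twistedModulation_apply`). -/
def twistedModulation {n : ℕ} (lam : ℝ) (η : R2 n) : 𝓢(R2 n, ℂ) →L[ℂ] 𝓢(R2 n, ℂ) :=
  (SchwartzMap.smulLeftCLM ℂ (modulationPhase lam η)).comp
    (SchwartzMap.compSubConstCLM ℂ (Real.tanh (lam / 2) • rotJ η))

/-- The operators `Π_λ(ξ, η) = e^{i (λ/2) (coth λ) ξ ⬝ η} e_λ(η) τ_λ(ξ)`, acting on Schwartz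
functions. -/
def repPi {n : ℕ} (lam : ℝ) (ξ η : R2 n) : 𝓢(R2 n, ℂ) →L[ℂ] 𝓢(R2 n, ℂ) :=
  Complex.exp (Complex.I * ((lam / 2 * coth lam * inner ℝ ξ η : ℝ) : ℂ)) •
    (twistedModulation lam η).comp (twistedTranslation lam ξ)

/-- The complex conjugate of a Schwartz function. -/
def conjS {n : ℕ} (g : 𝓢(R2 n, ℂ)) : 𝓢(R2 n, ℂ) :=
  SchwartzMap.postcompCLM (𝕜 := ℝ) Complex.conjCLE.toContinuousLinearMap g

/-- The sesquilinear pairing `⟨f, g⟩ = f(conj g)` of a tempered distribution and a Schwartz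
function; it extends `⟨f, g⟩ = ∫ f conj g`. -/
def pairing {n : ℕ} (f : 𝓢'(R2 n, ℂ)) (g : 𝓢(R2 n, ℂ)) : ℂ := f (conjS g)

/-- The twisted matrix coefficient `(ξ, η) ↦ ⟨f, Π_λ(ξ, η) g⟩`. -/
def matrixCoeff {n : ℕ} (lam : ℝ) (f : 𝓢'(R2 n, ℂ)) (g : 𝓢(R2 n, ℂ)) : R2 n × R2 n → ℂ :=
  fun z => pairing f (repPi lam z.1 z.2 g)

/-- The mixed norm `‖F‖_{p,q}`: the `L^p` norm in the first variable `ξ`, followed by the `L^q`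
norm in the second variable `η`, with essential suprema for infinite exponents. -/
def mixedNorm {n : ℕ} (p q : ℝ≥0∞) (F : R2 n × R2 n → ℂ) : ℝ≥0∞ :=
  eLpNorm (fun η : R2 n => eLpNorm (fun ξ : R2 n => F (ξ, η)) p volume) q volume

/-- `F` belongs to `L^{p,q}(ℝ^{2n} × ℝ^{2n})`. -/
def MemMixed {n : ℕ} (p q : ℝ≥0∞) (F : R2 n × R2 n → ℂ) : Prop :=
  AEStronglyMeasurable F (volume.prod volume) ∧ mixedNorm p q F < ∞

/-- The norm of `f` in `M_λ^{p,q}` defined by the window `g`. -/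
def windowNorm {n : ℕ} (lam : ℝ) (p q : ℝ≥0∞) (g : 𝓢(R2 n, ℂ)) (f : 𝓢'(R2 n, ℂ)) : ℝ≥0∞ :=
  mixedNorm p q (matrixCoeff lam f g)

/-- The twisted modulation space `M_λ^{p,q}(ℝ^{2n})`: the tempered distributions whose twisted
matrix coefficient lies in `L^{p,q}` for some window, that is, some nonzero Schwartz function. -/
def modulationSpace (n : ℕ) (lam : ℝ) (p q : ℝ≥0∞) : Set 𝓢'(R2 n, ℂ) :=
  {f | ∃ g : 𝓢(R2 n, ℂ), g ≠ 0 ∧ MemMixed p q (matrixCoeff lam f g)}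

section Formulas

lemma hasTemperateGrowth_expI :
    Function.HasTemperateGrowth (fun t : ℝ => Complex.exp (Complex.I * (t : ℂ))) := by
  have hd : ∀ t : ℝ, HasDerivAt (fun t : ℝ => Complex.exp (Complex.I * (t : ℂ)))
      (Complex.I * Complex.exp (Complex.I * (t : ℂ))) t := by
    intro t
    have h := ((Complex.ofRealCLM.hasDerivAt (x := t)).const_mul Complex.I).cexp
    simpa [mul_comm] using h
  have key : ∀ k : ℕ, iteratedDeriv k (fun t : ℝ => Complex.exp (Complex.I * (t : ℂ))) =
      fun t : ℝ => Complex.I ^ k * Complex.exp (Complex.I * (t : ℂ)) := by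
    intro k
    induction k with
    | zero => simp
    | succ k ih =>
      rw [iteratedDeriv_succ, ih]
      funext t
      rw [((hd t).const_mul (Complex.I ^ k)).deriv]
      ring
  refine ⟨?_, fun k => ⟨0, 1, fun t => ?_⟩⟩
  · exact (contDiff_const.mul Complex.ofRealCLM.contDiff).cexp
  · rw [norm_iteratedFDeriv_eq_norm_iteratedDeriv, key]
    simp [mul_comm Complex.I, Complex.norm_exp_ofReal_mul_I]

lemma hasTemperateGrowth_phase {n : ℕ} (η : R2 n) (c : ℝ) :
    Function.HasTemperateGrowth
      (fun X : R2 n => Complex.exp (Complex.I * ((c * inner ℝ X η : ℝ) : ℂ))) := by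
  refine hasTemperateGrowth_expI.comp (f := fun X : R2 n => c * inner ℝ X η) ?_
  exact (Function.HasTemperateGrowth.const c).mul (Function.hasTemperateGrowth_inner_left η)

lemma symp_eq_inner {n : ℕ} (X ξ : R2 n) : symp X ξ = -inner ℝ X (rotJ ξ) := by
  simp only [symp, rotJ, PiLp.inner_apply, Fintype.sum_sum_type, RCLike.inner_apply,
    conj_trivial, Sum.elim_inl, Sum.elim_inr, Finset.sum_sub_distrib, neg_mul,
    Finset.sum_neg_distrib]
  have h : ∑ i, X (Sum.inr i) * ξ (Sum.inl i) = ∑ i, ξ (Sum.inl i) * X (Sum.inr i) :=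
    Finset.sum_congr rfl fun i _ => mul_comm _ _
  rw [h]; ring

lemma hasTemperateGrowth_translationPhase {n : ℕ} (lam : ℝ) (ξ : R2 n) :
    Function.HasTemperateGrowth (translationPhase lam ξ) := by
  have h := hasTemperateGrowth_phase (rotJ ξ) (lam / 2)
  refine (congrArg Function.HasTemperateGrowth ?_).mpr h
  funext X
  simp only [translationPhase, symp_eq_inner]
  congr 3; ring

lemma hasTemperateGrowth_modulationPhase {n : ℕ} (lam : ℝ) (η : R2 n) :
    Function.HasTemperateGrowth (modulationPhase lam η) :=
  hasTemperateGrowth_phase η _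

/-- `τ_λ(ξ) g (X) = g (X - ξ) e^{-i (λ/2) [X, ξ]}`. -/
lemma twistedTranslation_apply {n : ℕ} (lam : ℝ) (ξ : R2 n) (g : 𝓢(R2 n, ℂ)) (X : R2 n) :
    twistedTranslation lam ξ g X =
      g (X - ξ) * Complex.exp (Complex.I * ((-(lam / 2) * symp X ξ : ℝ) : ℂ)) := by
  simp [twistedTranslation,
    SchwartzMap.smulLeftCLM_apply_apply (hasTemperateGrowth_translationPhase lam ξ),
    translationPhase, mul_comm]

/-- `e_λ(η) g (X) = g (X - tanh(λ/2) J η) e^{-i (λ/2) coth(λ/2) X ⬝ η}`, where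
`J (a, b) = (b, -a)`. -/
lemma twistedModulation_apply {n : ℕ} (lam : ℝ) (η : R2 n) (g : 𝓢(R2 n, ℂ)) (X : R2 n) :
    twistedModulation lam η g X =
      g (X - Real.tanh (lam / 2) • rotJ η) *
        Complex.exp (Complex.I * ((-(lam / 2) * coth (lam / 2) * inner ℝ X η : ℝ) : ℂ)) := by
  simp [twistedModulation,
    SchwartzMap.smulLeftCLM_apply_apply (hasTemperateGrowth_modulationPhase lam η),
    modulationPhase, mul_comm]

lemma conjS_apply {n : ℕ} (g : 𝓢(R2 n, ℂ)) (X : R2 n) :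
    conjS g X = (starRingEnd ℂ) (g X) := rfl

end Formulas

section Bargmann

/-- The symplectic form extended bilinearly to `ℂ^{2n}`. -/
def csymp {n : ℕ} (ζ ω : Fin n ⊕ Fin n → ℂ) : ℂ :=
  ∑ i, (ζ (Sum.inr i) * ω (Sum.inl i) - ω (Sum.inr i) * ζ (Sum.inl i))

/-- The inclusion of `ℝ^{2n}` in `ℂ^{2n}`. -/
def toC {n : ℕ} (ξ : R2 n) : Fin n ⊕ Fin n → ℂ := fun j => (ξ j : ℂ)

/-- The constant `(4π)^{-n} λ^n (sinh tλ)^{-n}` of the heat kernel. -/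
def heatConst (n : ℕ) (lam t : ℝ) : ℝ :=
  ((4 * Real.pi) ^ n)⁻¹ * lam ^ n * (Real.sinh (t * lam) ^ n)⁻¹

/-- The heat kernel `p_t^λ` of the special Hermite operator, extended to `ℂ^{2n}`. -/
def heatKernel {n : ℕ} (lam t : ℝ) (ζ : Fin n ⊕ Fin n → ℂ) : ℂ :=
  (heatConst n lam t : ℂ) *
    Complex.exp (-((lam * coth (t * lam) : ℝ) : ℂ) / 4 * (ζ ⬝ᵥ ζ))

/-- The twisted Bargmann transform `B_λ g (ζ) = c_λ p_1^λ(ζ)⁻¹ (g ∗_λ p_{1/2}^λ)(ζ)`, where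
`g ∗_λ h (ζ) = ∫ g(Y) h(ζ - Y) e^{-i (λ/2) [ζ, Y]} dY` and `c_λ` is the constant of `p_1^λ`. -/
def bargmann {n : ℕ} (lam : ℝ) (g : 𝓢(R2 n, ℂ)) (ζ : Fin n ⊕ Fin n → ℂ) : ℂ :=
  (heatConst n lam 1 : ℂ) * (heatKernel lam 1 ζ)⁻¹ *
    ∫ Y : R2 n, g Y * heatKernel lam (1 / 2) (ζ - toC Y) *
      Complex.exp (-Complex.I * (lam / 2) * csymp ζ (toC Y))

/-- The operators `ρ_λ(ξ + iη)` of the twisted Fock space: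
`ρ_λ(ζ') F (ζ) = F (ζ - ζ') e^{(λ/2) (coth λ) ζ ⬝ conj ζ'} e^{-i (λ/2) [ζ, conj ζ']}
e^{-(λ/4) (coth λ) |ζ'|^2} e^{(λ/2) [Re ζ', Im ζ']}`. -/
def fockRep {n : ℕ} (lam : ℝ) (ξ η : R2 n) (F : (Fin n ⊕ Fin n → ℂ) → ℂ)
    (ζ : Fin n ⊕ Fin n → ℂ) : ℂ :=
  F (ζ - (toC ξ + Complex.I • toC η)) *
    Complex.exp ((lam / 2) * (coth lam : ℂ) * (ζ ⬝ᵥ (toC ξ - Complex.I • toC η))) *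
    Complex.exp (-Complex.I * (lam / 2) * csymp ζ (toC ξ - Complex.I • toC η)) *
    Complex.exp (((-(lam / 4) * coth lam * (‖ξ‖ ^ 2 + ‖η‖ ^ 2) : ℝ) : ℂ)) *
    Complex.exp (((lam / 2 * symp ξ η : ℝ) : ℂ))

lemma coth_relations {lam : ℝ} (hlam : lam ≠ 0) :
    Real.tanh (lam / 2) * coth (lam / 2) = 1 ∧
      coth lam = (coth (lam / 2) + Real.tanh (lam / 2)) / 2 := by
  have hs : Real.sinh (lam / 2) ≠ 0 := by
    intro h
    rw [Real.sinh_eq_zero] at h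
    exact hlam (by linarith)
  have hc : Real.cosh (lam / 2) ≠ 0 := (Real.cosh_pos _).ne'
  have e : lam = 2 * (lam / 2) := by ring
  refine ⟨?_, ?_⟩
  · rw [coth, Real.tanh_eq_sinh_div_cosh]; field_simp
  · have h1 : coth lam = (Real.cosh (lam / 2) ^ 2 + Real.sinh (lam / 2) ^ 2) /
        (2 * Real.sinh (lam / 2) * Real.cosh (lam / 2)) := by
      conv_lhs => rw [e]
      rw [coth, Real.cosh_two_mul, Real.sinh_two_mul]
    rw [h1, coth, Real.tanh_eq_sinh_div_cosh]; field_simp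

/-- `B_λ ∘ Π_λ(ξ, η) = ρ_λ(ξ + iη) ∘ B_λ`: the explicit operators `Π_λ(ξ, η)` are the ones
obtained from `ρ_λ(ξ + iη)` by conjugation with the twisted Bargmann transform. -/
theorem bargmann_repPi {n : ℕ} {lam : ℝ} (hlam : lam ≠ 0) (ξ η : R2 n) (g : 𝓢(R2 n, ℂ)) :
    bargmann lam (repPi lam ξ η g) = fockRep lam ξ η (bargmann lam g) := by
  obtain ⟨hTC, hcoth⟩ := coth_relations hlam
  have hTC' : ((Real.tanh (lam / 2) : ℝ) : ℂ) * ((coth (lam / 2) : ℝ) : ℂ) = 1 := by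
    exact_mod_cast hTC
  have h12 : (1 / 2 : ℝ) * lam = lam / 2 := by ring
  funext ζ
  set s : R2 n := Real.tanh (lam / 2) • rotJ η + ξ with hs
  unfold fockRep bargmann
  rw [← integral_add_right_eq_self _ s]
  simp only [heatKernel, mul_inv, ← Complex.exp_neg, h12, one_mul]
  have key : ∀ (A B E S1 S2 S3 S4 : ℂ) (L R : R2 n → ℂ),
      (∀ Y, E * L Y = (B * S1 * S2 * S3 * S4) * R Y) →
      A * (A⁻¹ * E) * ∫ Y, L Y = (A * (A⁻¹ * B) * ∫ Y, R Y) * S1 * S2 * S3 * S4 := by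
    intro A B E S1 S2 S3 S4 L R h
    have h' : E * ∫ Y, L Y = (B * S1 * S2 * S3 * S4) * ∫ Y, R Y := by
      rw [← integral_const_mul, ← integral_const_mul]
      exact integral_congr_ae (Filter.Eventually.of_forall h)
    linear_combination (A * A⁻¹) * h'
  refine key _ _ _ _ _ _ _ _ _ fun Y => ?_
  have e1 : repPi lam ξ η g (Y + s) =
      Complex.exp (Complex.I * ((lam / 2 * coth lam * inner ℝ ξ η : ℝ) : ℂ)) *
      (g Y * Complex.exp (Complex.I * ((-(lam / 2) * symp (Y + ξ) ξ : ℝ) : ℂ)) *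
      Complex.exp
        (Complex.I * ((-(lam / 2) * coth (lam / 2) * inner ℝ (Y + s) η : ℝ) : ℂ))) := by
    have a1 : Y + s - Real.tanh (lam / 2) • rotJ η = Y + ξ := by rw [hs]; abel
    have a2 : Y + ξ - ξ = Y := by abel
    change Complex.exp _ * (twistedModulation lam η (twistedTranslation lam ξ g) (Y + s)) = _
    rw [twistedModulation_apply, twistedTranslation_apply, a1, a2]
  rw [e1]
  have comb : ∀ (a b c d e f k l m o r t u G H : ℂ), a + b + c + d + e + f =
      k + l + m + o + r + t + u →
      Complex.exp a * (Complex.exp b * (G * Complex.exp c * Complex.exp d) *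
        (H * Complex.exp e) * Complex.exp f) =
      (Complex.exp k * Complex.exp l * Complex.exp m * Complex.exp o * Complex.exp r) *
        (G * (H * Complex.exp t) * Complex.exp u) := by
    intro a b c d e f k l m o r t u G H h
    have h' := congrArg Complex.exp h
    simp only [Complex.exp_add] at h'
    linear_combination (G * H) * h'
  apply comb
  rw [hcoth, ← real_inner_self_eq_norm_sq, ← real_inner_self_eq_norm_sq, hs]
  simp only [csymp, symp, toC, rotJ, dotProduct, PiLp.inner_apply, RCLike.inner_apply,
    conj_trivial, Fintype.sum_sum_type, Pi.sub_apply, Pi.add_apply, Pi.smul_apply,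
    PiLp.add_apply, PiLp.smul_apply, smul_eq_mul, Sum.elim_inl, Sum.elim_inr]
  push_cast at hTC' ⊢
  simp only [Finset.mul_sum, ← Finset.sum_add_distrib,
    ← Finset.sum_neg_distrib]
  refine Finset.sum_congr rfl fun i _ => ?_
  have hI := Complex.I_sq
  clear * - hTC' hI
  generalize Complex.tanh (↑lam / 2) = T at *
  generalize ((coth (lam / 2) : ℝ) : ℂ) = C at *
  generalize ((ξ.ofLp (Sum.inl i) : ℝ) : ℂ) = a
  generalize ((ξ.ofLp (Sum.inr i) : ℝ) : ℂ) = b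
  generalize ((η.ofLp (Sum.inl i) : ℝ) : ℂ) = c
  generalize ((η.ofLp (Sum.inr i) : ℝ) : ℂ) = d
  generalize ((Y.ofLp (Sum.inl i) : ℝ) : ℂ) = x
  generalize ((Y.ofLp (Sum.inr i) : ℝ) : ℂ) = y
  generalize ζ (Sum.inl i) = z
  generalize ζ (Sum.inr i) = w
  generalize (lam : ℂ) = L
  generalize Complex.I = J at *
  grind

end Bargmann

end TwistedModulation

end

open TwistedModulation

/-! The twisted setting is the ordinary time-frequency setting in other coordinates. Up to a
unimodular factor, `conj (Π_λ(ξ, η) g)` is the shift of `conj g` by the position `s = ξ + tanh(λ/2)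
Jη` and the frequency `w = (λ/4π)(coth(λ/2) η - Jξ)` (`conjS_repPi`), and `(ξ, η) ↦ (s, w)` is
linear and invertible because `coth - tanh` does not vanish.

For time-frequency shifts `T(z)`, the inversion formula `(∫ γ g) h = ∫ stft γ h (z) T(z) g dz` may
be tested against a tempered distribution `f`. With `h = T(z₀) g'`, covariance of the short-time
Fourier transform bounds `|f(T(z₀) g')|` by a convolution of `|f(T(z) g)|` with a rapidly decreasing
kernel (`enorm_apply_timeFreqShift_le`). A mixed norm is not preserved by the change of coordinates,
but linearity turns translations into translations. So the kernel becomes a finite measure in the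
variables `(ξ, η)`, independent of `f` (`exists_enorm_matrixCoeff_le`), and Young's inequality for
mixed norms, which is Minkowski's inequality applied twice, compares the two window norms
(`exists_windowNorm_le`).

Definiteness comes from the same estimate: coefficients are continuous, so a zero norm makes them
vanish identically, and changing the window then kills `f` on every test function. -/

section

open MeasureTheory Filter Topology
open scoped FourierTransform BoundedContinuousFunction LineDeriv

/-! ### Tempered distributions and integrals of Schwartz functions -/

section VectorIntegrals

variable {V : Type} [NormedAddCommGroup V] [NormedSpace ℝ V]
  {Z : Type*} [TopologicalSpace Z] [MeasurableSpace Z] [OpensMeasurableSpace Z]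
  [SecondCountableTopology Z] {ν : Measure Z}

theorem SchwartzMap.continuous_eval_const {F : Type} [NormedAddCommGroup F] [NormedSpace ℝ F]
    (x : V) : Continuous fun φ : 𝓢(V, F) => φ x :=
  (ContinuousEvalConst.continuous_eval_const (F := V →ᵇ F) x).comp
    (SchwartzMap.toBoundedContinuousFunctionCLM ℝ V F).continuous

/-- Differentiation under the integral sign for integrals of Schwartz functions. -/
theorem SchwartzMap.fderiv_eq_integral {F : Type} [NormedAddCommGroup F] [NormedSpace ℝ F]
    {u : Z → 𝓢(V, F)} {h : 𝓢(V, F)} (hu : Continuous u)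
    (hi : ∀ k l, Integrable (fun z => SchwartzMap.seminorm ℝ k l (u z)) ν)
    (hh : ∀ x, h x = ∫ z, u z x ∂ν) (x : V) :
    fderiv ℝ h x = ∫ z, fderiv ℝ (u z) x ∂ν := by
  have hm : ∀ x, Continuous fun z => u z x := fun x =>
    (SchwartzMap.continuous_eval_const x).comp hu
  have hm' : Continuous fun z => fderiv ℝ (u z) x :=
    (SchwartzMap.continuous_eval_const x).comp ((SchwartzMap.fderivCLM ℝ V F).continuous.comp hu)
  have key := hasFDerivAt_integral_of_dominated_of_fderiv_le (𝕜 := ℝ) (μ := ν)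
    (F := fun x z => u z x) (F' := fun x z => fderiv ℝ (u z) x) (x₀ := x) (s := Set.univ)
    (bound := fun z => SchwartzMap.seminorm ℝ 0 1 (u z)) univ_mem
    (Eventually.of_forall fun x => (hm x).aestronglyMeasurable)
    ((hi 0 0).mono' (hm x).aestronglyMeasurable
      (Eventually.of_forall fun z => SchwartzMap.norm_le_seminorm ℝ _ _))
    hm'.aestronglyMeasurable
    (Eventually.of_forall fun z x _ => by
      have := SchwartzMap.norm_iteratedFDeriv_le_seminorm ℝ (u z) 1 x
      rwa [norm_iteratedFDeriv_one] at this)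
    (hi 0 1) (Eventually.of_forall fun z x _ => (u z).hasFDerivAt x)
  have e : (h : V → F) = fun x => ∫ z, u z x ∂ν := funext hh
  rw [e]
  exact key.fderiv

/-- Induction on the order of the derivative. The target space is quantified inside because `fderiv`
changes it to `V →L[ℝ] F`. Integrability is carried along so that the integral can later be
evaluated at given directions. -/
theorem SchwartzMap.iteratedFDeriv_eq_integral (l : ℕ) : ∀ {F : Type} [NormedAddCommGroup F]
    [NormedSpace ℝ F] {u : Z → 𝓢(V, F)} {h : 𝓢(V, F)}, Continuous u →
    (∀ k l, Integrable (fun z => SchwartzMap.seminorm ℝ k l (u z)) ν) →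
    (∀ x, h x = ∫ z, u z x ∂ν) →
    ∀ x, Integrable (fun z => iteratedFDeriv ℝ l (u z) x) ν ∧
      iteratedFDeriv ℝ l h x = ∫ z, iteratedFDeriv ℝ l (u z) x ∂ν := by
  induction l with
  | zero =>
    intro F _ _ u h hu hi hh x
    simp only [iteratedFDeriv_zero_eq_comp, Function.comp_apply]
    rw [hh x]
    refine ⟨(continuousMultilinearCurryFin0 ℝ V
      F).symm.toContinuousLinearEquiv.integrable_comp_iff.mpr
      ((hi 0 0).mono' ((SchwartzMap.continuous_eval_const x).comp hu).aestronglyMeasurable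
        (Eventually.of_forall fun z => SchwartzMap.norm_le_seminorm ℝ _ _)), ?_⟩
    exact ((continuousMultilinearCurryFin0 ℝ V F).symm.toContinuousLinearEquiv.integral_comp_comm
      (fun z => u z x)).symm
  | succ l ih =>
    intro F _ _ u h hu hi hh x
    have h1 := ih (u := fun z => SchwartzMap.fderivCLM ℝ V F (u z))
      (h := SchwartzMap.fderivCLM ℝ V F h)
      ((SchwartzMap.fderivCLM ℝ V F).continuous.comp hu)
      (fun k l => by
        refine (hi k (l + 1)).mono' ?_ (Eventually.of_forall fun z => ?_)
        · exact (((schwartz_withSeminorms ℝ V (V →L[ℝ] F)).continuous_seminorm (k, l)).comp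
            ((SchwartzMap.fderivCLM ℝ V F).continuous.comp hu)).aestronglyMeasurable
        · rw [Real.norm_of_nonneg (apply_nonneg _ _)]
          refine SchwartzMap.seminorm_le_bound ℝ k l _ (apply_nonneg _ _) fun x => ?_
          have e : (SchwartzMap.fderivCLM ℝ V F (u z) : V → V →L[ℝ] F) = fderiv ℝ (u z) := by
            ext1 y; simp
          rw [e, norm_iteratedFDeriv_fderiv]
          exact SchwartzMap.le_seminorm ℝ k (l + 1) (u z) x)
      (fun x => by simpa using SchwartzMap.fderiv_eq_integral hu hi hh x) x
    have e : ∀ φ : 𝓢(V, F), (SchwartzMap.fderivCLM ℝ V F φ : V → V →L[ℝ] F) =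
        fun y => fderiv ℝ φ y := fun φ => by ext1 y; simp
    simp only [e] at h1
    simp only [iteratedFDeriv_succ_eq_comp_right, Function.comp_apply]
    refine ⟨h1.1.norm.mono'
      ((continuousMultilinearCurryRightEquiv' ℝ l V F).symm.continuous.comp_aestronglyMeasurable
        h1.1.aestronglyMeasurable) (Eventually.of_forall fun z =>
      ((continuousMultilinearCurryRightEquiv' ℝ l V F).symm.norm_map _).le), ?_⟩
    rw [h1.2]
    exact (ContinuousLinearEquiv.integral_comp_comm (μ := ν) (𝕜 := ℝ) (E := V [×l]→L[ℝ] V →L[ℝ] F)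
      (F := V [×(l + 1)]→L[ℝ] F)
      (continuousMultilinearCurryRightEquiv' ℝ l V F).symm.toContinuousLinearEquiv _).symm

/-- The derivative `‖x‖ ^ k • D^l φ(x)(m₁, …, m_l)`, as a bounded continuous function of a point `x`
and of directions `m_i` in the unit ball. -/
noncomputable def SchwartzMap.weightedDeriv (k l : ℕ) :
    𝓢(V, ℂ) →ₗ[ℂ] (V × {m : Fin l → V // ∀ i, ‖m i‖ ≤ 1} →ᵇ ℂ) where
  toFun φ := BoundedContinuousFunction.ofNormedAddCommGroup
    (fun x => ‖x.1‖ ^ k • iteratedFDeriv ℝ l φ x.1 x.2.1)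
    (((continuous_norm.comp continuous_fst).pow k).smul
      ((((φ.smooth ⊤).continuous_iteratedFDeriv (mod_cast le_top)).comp continuous_fst).eval
        (continuous_subtype_val.comp continuous_snd)))
    (SchwartzMap.seminorm ℂ k l φ)
    (fun x => by
      rw [norm_smul, norm_pow, norm_norm]
      refine le_trans ?_ (SchwartzMap.le_seminorm ℂ k l φ x.1)
      gcongr
      refine ((iteratedFDeriv ℝ l φ x.1).le_opNorm _).trans ?_
      exact mul_le_of_le_one_right (norm_nonneg _)
        (Finset.prod_le_one (fun _ _ => norm_nonneg _) fun i _ => x.2.2 i))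
  map_add' φ ψ := by
    ext1 x
    have h : iteratedFDeriv ℝ l (φ + ψ : V → ℂ) x.1 =
        iteratedFDeriv ℝ l φ x.1 + iteratedFDeriv ℝ l ψ x.1 :=
      iteratedFDeriv_add_apply ((φ.smooth l).contDiffAt) ((ψ.smooth l).contDiffAt)
    simp only [BoundedContinuousFunction.coe_ofNormedAddCommGroup,
      BoundedContinuousFunction.coe_add, Pi.add_apply, ← smul_add]
    exact congrArg (fun D : V [×l]→L[ℝ] ℂ => ‖x.1‖ ^ k • D x.2.1) h
  map_smul' c φ := by
    ext1 x
    have h : iteratedFDeriv ℝ l (c • φ : V → ℂ) x.1 = c • iteratedFDeriv ℝ l φ x.1 :=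
      iteratedFDeriv_const_smul_apply ((φ.smooth l).contDiffAt)
    simp only [BoundedContinuousFunction.coe_ofNormedAddCommGroup, RingHom.id_apply,
      BoundedContinuousFunction.coe_smul]
    rw [smul_comm]
    exact congrArg (fun D : V [×l]→L[ℝ] ℂ => ‖x.1‖ ^ k • D x.2.1) h

theorem SchwartzMap.weightedDeriv_apply (k l : ℕ) (φ : 𝓢(V, ℂ))
    (x : V × {m : Fin l → V // ∀ i, ‖m i‖ ≤ 1}) :
    SchwartzMap.weightedDeriv k l φ x = ‖x.1‖ ^ k • iteratedFDeriv ℝ l φ x.1 x.2.1 := rfl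

theorem SchwartzMap.norm_weightedDeriv_le (k l : ℕ) (φ : 𝓢(V, ℂ)) :
    ‖SchwartzMap.weightedDeriv k l φ‖ ≤ SchwartzMap.seminorm ℂ k l φ := by
  refine (BoundedContinuousFunction.norm_le (apply_nonneg _ _)).mpr fun x => ?_
  rw [SchwartzMap.weightedDeriv_apply, norm_smul, norm_pow, norm_norm]
  refine le_trans ?_ (SchwartzMap.le_seminorm ℂ k l φ x.1)
  gcongr
  refine ((iteratedFDeriv ℝ l φ x.1).le_opNorm _).trans ?_
  exact mul_le_of_le_one_right (norm_nonneg _)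
    (Finset.prod_le_one (fun _ _ => norm_nonneg _) fun i _ => x.2.2 i)

/-- By multilinearity, directions in the unit ball already determine the operator norm. Hence each
Schwartz seminorm is the norm of a linear image in a Banach space of bounded continuous functions,
where Bochner integrals make sense. -/
theorem SchwartzMap.seminorm_le_norm_weightedDeriv (k l : ℕ) (φ : 𝓢(V, ℂ)) :
    SchwartzMap.seminorm ℂ k l φ ≤ ‖SchwartzMap.weightedDeriv k l φ‖ := by
  refine SchwartzMap.seminorm_le_bound ℂ k l _ (norm_nonneg _) fun x => ?_
  rw [← norm_norm x, ← norm_pow, ← norm_smul]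
  refine ContinuousMultilinearMap.opNorm_le_bound (norm_nonneg _) fun m => ?_
  by_cases hm : ∃ i, m i = 0
  · obtain ⟨i, hi⟩ := hm
    rw [ContinuousMultilinearMap.map_coord_zero _ i hi, norm_zero]
    positivity
  · push Not at hm
    have hn : ∀ i, ‖m i‖ ≠ 0 := fun i => norm_ne_zero_iff.mpr (hm i)
    have e : m = fun i => ‖m i‖ • (‖m i‖⁻¹ • m i) := by
      funext i
      rw [smul_smul, mul_inv_cancel₀ (hn i), one_smul]
    have hb := (SchwartzMap.weightedDeriv k l φ).norm_coe_le_norm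
      (x, ⟨fun i => ‖m i‖⁻¹ • m i, fun i => by
        rw [norm_smul, norm_inv, norm_norm, inv_mul_cancel₀ (hn i)]⟩)
    rw [SchwartzMap.weightedDeriv_apply] at hb
    conv_lhs => rw [e]
    rw [ContinuousMultilinearMap.map_smul_univ, norm_smul, norm_prod, mul_comm]
    simp only [norm_norm]
    gcongr
    exact hb

/-- A linear functional that is bounded by the norm of a linear map into a normed space extends
along that map. -/
theorem LinearMap.exists_dual_comp_eq {W E : Type*} [AddCommGroup W] [Module ℂ W]
    [NormedAddCommGroup E] [NormedSpace ℂ E] (Φ : W →ₗ[ℂ] E) (f : W →ₗ[ℂ] ℂ) (C : ℝ)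
    (hf : ∀ w, ‖f w‖ ≤ C * ‖Φ w‖) : ∃ L : StrongDual ℂ E, ∀ w, L (Φ w) = f w := by
  have hker : LinearMap.ker Φ ≤ LinearMap.ker f := by
    intro w hw
    rw [LinearMap.mem_ker] at hw ⊢
    have := hf w
    rw [hw, norm_zero, mul_zero] at this
    exact norm_le_zero_iff.mp this
  let f₀ : LinearMap.range Φ →ₗ[ℂ] ℂ :=
    (LinearMap.ker Φ).liftQ f hker ∘ₗ Φ.quotKerEquivRange.symm.toLinearMap
  have hf₀ : ∀ w, f₀ ⟨Φ w, LinearMap.mem_range_self Φ w⟩ = f w := by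
    intro w
    have : Φ.quotKerEquivRange.symm ⟨Φ w, LinearMap.mem_range_self Φ w⟩ =
        (LinearMap.ker Φ).mkQ w := by
      rw [LinearEquiv.symm_apply_eq]; rfl
    simp only [f₀, LinearMap.comp_apply, LinearEquiv.coe_coe, this]
    rfl
  obtain ⟨L, hL, -⟩ := exists_extension_norm_eq (𝕜 := ℂ) (LinearMap.range Φ)
    (f₀.mkContinuous C (by
      rintro ⟨_, w, rfl⟩
      rw [hf₀]
      exact hf w))
  exact ⟨L, fun w => (hL ⟨Φ w, LinearMap.mem_range_self Φ w⟩).trans (hf₀ w)⟩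

omit [TopologicalSpace Z] [OpensMeasurableSpace Z] [SecondCountableTopology Z] in
-- By Hahn–Banach, `f` factors through the finite product of the Banach spaces `E i`, and a
-- continuous functional there commutes with the Bochner integral. No topology on `W` is needed.
theorem LinearMap.apply_eq_integral_of_norm_le {W ι : Type*} [AddCommGroup W] [Module ℂ W]
    [Fintype ι] {E : ι → Type*} [∀ i, NormedAddCommGroup (E i)] [∀ i, NormedSpace ℂ (E i)]
    [∀ i, CompleteSpace (E i)] (Φ : ∀ i, W →ₗ[ℂ] E i) (f : W →ₗ[ℂ] ℂ) {C : ℝ}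
    (hf : ∀ w, ‖f w‖ ≤ C * ‖fun i => Φ i w‖) {u : Z → W} {h : W}
    (hi : ∀ i, Integrable (fun z => Φ i (u z)) ν) (hh : ∀ i, Φ i h = ∫ z, Φ i (u z) ∂ν) :
    f h = ∫ z, f (u z) ∂ν := by
  obtain ⟨L, hL⟩ := LinearMap.exists_dual_comp_eq (LinearMap.pi Φ) f C hf
  have hi' : Integrable (fun z => LinearMap.pi Φ (u z)) ν := Integrable.of_eval hi
  have hint : LinearMap.pi Φ h = ∫ z, LinearMap.pi Φ (u z) ∂ν := by
    funext i
    exact (hh i).trans (eval_integral hi i).symm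
  simp only [← hL]
  rw [hint, L.integral_comp_comm hi']

/-- A tempered distribution commutes with absolutely convergent integrals of Schwartz functions. -/
theorem TemperedDistribution.apply_eq_integral (f : 𝓢'(V, ℂ)) {u : Z → 𝓢(V, ℂ)} {h : 𝓢(V, ℂ)}
    (hu : Continuous u)
    (hi : ∀ k l, Integrable (fun z => SchwartzMap.seminorm ℝ k l (u z)) ν)
    (hh : ∀ x, h x = ∫ z, u z x ∂ν) : f h = ∫ z, f (u z) ∂ν := by
  -- Continuity of `f` involves only finitely many seminorms; these index the finite product of
  -- Banach spaces used below.
  obtain ⟨s, C, -, hC⟩ := Seminorm.bound_of_continuous (schwartz_withSeminorms ℂ V ℂ)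
    ((normSeminorm ℂ ℂ).comp (f : 𝓢(V, ℂ) →L[ℂ] ℂ).toLinearMap)
    (continuous_norm.comp (f : 𝓢(V, ℂ) →L[ℂ] ℂ).continuous)
  have hcomp : ∀ k l, Continuous fun φ : 𝓢(V, ℂ) => SchwartzMap.weightedDeriv k l φ := by
    intro k l
    refine WithSeminorms.continuous_of_isBounded (schwartz_withSeminorms ℂ V ℂ)
      (norm_withSeminorms ℂ _) _ fun _ => ⟨{(k, l)}, 1, fun φ => ?_⟩
    simpa using SchwartzMap.norm_weightedDeriv_le k l φ
  have hint : ∀ k l, Integrable (fun z => SchwartzMap.weightedDeriv k l (u z)) ν := fun k l =>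
    (hi k l).mono' ((hcomp k l).comp hu).aestronglyMeasurable
      (Eventually.of_forall fun z => SchwartzMap.norm_weightedDeriv_le k l (u z))
  refine LinearMap.apply_eq_integral_of_norm_le (C := C)
    (E := fun i : s => (V × {m : Fin i.1.2 → V // ∀ i, ‖m i‖ ≤ 1} →ᵇ ℂ))
    (fun i => SchwartzMap.weightedDeriv i.1.1 i.1.2) (f : 𝓢(V, ℂ) →L[ℂ] ℂ).toLinearMap
    (fun φ => (hC φ).trans (mul_le_mul_of_nonneg_left ?_ C.2)) (fun i => hint _ _) fun i => ?_
  · refine Seminorm.finset_sup_apply_le (norm_nonneg _) fun i hi => ?_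
    exact (SchwartzMap.seminorm_le_norm_weightedDeriv i.1 i.2 φ).trans
      (norm_le_pi_norm (fun i : s => SchwartzMap.weightedDeriv i.1.1 i.1.2 φ) ⟨i, hi⟩)
  · ext1 x
    -- Point evaluation is continuous on bounded continuous functions, so equality of the vector
    -- integrals is checked pointwise.
    refine Eq.trans ?_ ((BoundedContinuousFunction.evalCLM ℂ x).integral_comp_comm
      (hint i.1.1 i.1.2))
    change ‖x.1‖ ^ i.1.1 • iteratedFDeriv ℝ i.1.2 h x.1 x.2.1 =
      ∫ z, ‖x.1‖ ^ i.1.1 • iteratedFDeriv ℝ i.1.2 (u z) x.1 x.2.1 ∂ν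
    have h1 := SchwartzMap.iteratedFDeriv_eq_integral i.1.2 hu hi hh x.1
    rw [integral_smul, h1.2, ContinuousMultilinearMap.integral_apply h1.1]

end VectorIntegrals

/-! ### Time-frequency shifts on the Schwartz space -/

section TimeFrequencyShifts

namespace SchwartzMap

section Translation

variable {V : Type} [NormedAddCommGroup V] [NormedSpace ℝ V]

theorem iteratedFDeriv_compSubConstCLM (s : V) (φ : 𝓢(V, ℂ)) (l : ℕ) (x : V) :
    iteratedFDeriv ℝ l (compSubConstCLM ℂ s φ) x = iteratedFDeriv ℝ l φ (x - s) :=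
  congrFun (iteratedFDeriv_comp_sub' l s) x

omit [NormedSpace ℝ V] in
theorem norm_le_one_add_mul_one_add_norm_sub {s x : V} {R : ℝ} (hs : ‖s‖ ≤ R) :
    ‖x‖ ≤ (1 + R) * (1 + ‖x - s‖) := by
  have h1 : ‖x‖ ≤ ‖x - s‖ + ‖s‖ := by simpa using norm_add_le (x - s) s
  have h2 : 0 ≤ R * ‖x - s‖ := mul_nonneg ((norm_nonneg _).trans hs) (norm_nonneg _)
  nlinarith [norm_nonneg (x - s)]

theorem norm_pow_mul_iteratedFDeriv_sub_le (k l : ℕ) {s : V} {R : ℝ} (hs : ‖s‖ ≤ R) (φ : 𝓢(V, ℂ))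
    (x : V) : ‖x‖ ^ k * ‖iteratedFDeriv ℝ l φ (x - s)‖ ≤
      (1 + R) ^ k * (2 ^ k * ((Finset.Iic (k, l)).sup (schwartzSeminormFamily ℂ V ℂ)) φ) := by
  have h := one_add_le_sup_seminorm_apply (𝕜 := ℂ) (m := (k, l)) le_rfl le_rfl φ (x - s)
  calc ‖x‖ ^ k * ‖iteratedFDeriv ℝ l φ (x - s)‖
      ≤ ((1 + R) * (1 + ‖x - s‖)) ^ k * ‖iteratedFDeriv ℝ l φ (x - s)‖ := by
        gcongr
        exact norm_le_one_add_mul_one_add_norm_sub hs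
    _ = (1 + R) ^ k * ((1 + ‖x - s‖) ^ k * ‖iteratedFDeriv ℝ l φ (x - s)‖) := by
        rw [mul_pow, mul_assoc]
    _ ≤ _ := by
        have : 0 ≤ R := (norm_nonneg _).trans hs
        exact mul_le_mul_of_nonneg_left h (by positivity)

theorem seminorm_compSubConstCLM_le (k l : ℕ) {s : V} {R : ℝ} (hs : ‖s‖ ≤ R) (φ : 𝓢(V, ℂ)) :
    SchwartzMap.seminorm ℂ k l (compSubConstCLM ℂ s φ) ≤
      (1 + R) ^ k * (2 ^ k * ((Finset.Iic (k, l)).sup (schwartzSeminormFamily ℂ V ℂ)) φ) := by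
  have : 0 ≤ R := (norm_nonneg _).trans hs
  refine seminorm_le_bound ℂ k l _ (by positivity) fun x => ?_
  rw [iteratedFDeriv_compSubConstCLM]
  exact norm_pow_mul_iteratedFDeriv_sub_le k l hs φ x

/-- Mean value inequality on the segment from `x - t` to `x - s`, at the cost of one more
derivative. Points of the segment are `x - r` with `‖r‖ ≤ R`, so the weight `‖x‖ ^ k` is controlled
uniformly. -/
theorem seminorm_compSubConstCLM_sub_le (k l : ℕ) {s t : V} {R : ℝ} (hs : ‖s‖ ≤ R) (ht : ‖t‖ ≤ R)
    (φ : 𝓢(V, ℂ)) :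
    SchwartzMap.seminorm ℂ k l (compSubConstCLM ℂ s φ - compSubConstCLM ℂ t φ) ≤
      (1 + R) ^ k * (2 ^ k * ((Finset.Iic (k, l + 1)).sup (schwartzSeminormFamily ℂ V ℂ)) φ) *
        ‖s - t‖ := by
  have : 0 ≤ R := (norm_nonneg _).trans hs
  refine seminorm_le_bound ℂ k l _ (by positivity) fun x => ?_
  have e : iteratedFDeriv ℝ l (compSubConstCLM ℂ s φ - compSubConstCLM ℂ t φ : 𝓢(V, ℂ)) x =
      iteratedFDeriv ℝ l φ (x - s) - iteratedFDeriv ℝ l φ (x - t) := by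
    rw [← iteratedFDeriv_compSubConstCLM, ← iteratedFDeriv_compSubConstCLM]
    exact iteratedFDeriv_sub_apply (smooth _ l).contDiffAt (smooth _ l).contDiffAt
  have hd : Differentiable ℝ (iteratedFDeriv ℝ l φ) :=
    (φ.smooth ⊤).differentiable_iteratedFDeriv (mod_cast ENat.natCast_lt_top l)
  have key := (convex_segment (x - t) (x - s)).norm_image_sub_le_of_norm_hasFDerivWithin_le
    (f := fun y => ‖x‖ ^ k • iteratedFDeriv ℝ l φ y)
    (f' := fun y => ‖x‖ ^ k • fderiv ℝ (iteratedFDeriv ℝ l φ) y)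
    (C := (1 + R) ^ k * (2 ^ k * ((Finset.Iic (k, l + 1)).sup (schwartzSeminormFamily ℂ V ℂ)) φ))
    (fun y _ => ((hd y).hasFDerivAt.const_smul (‖x‖ ^ k)).hasFDerivWithinAt)
    (fun y hy => by
      obtain ⟨a, b, ha, hb, hab, rfl⟩ := hy
      have e1 : a • (x - t) + b • (x - s) = x - (a • t + b • s) := by
        rw [smul_sub, smul_sub]
        nth_rewrite 3 [← one_smul ℝ x]
        rw [← hab, add_smul]; abel
      rw [e1, norm_smul, norm_pow, norm_norm, norm_fderiv_iteratedFDeriv]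
      refine norm_pow_mul_iteratedFDeriv_sub_le k (l + 1) ?_ φ x
      calc ‖a • t + b • s‖ ≤ ‖a • t‖ + ‖b • s‖ := norm_add_le _ _
        _ = a * ‖t‖ + b * ‖s‖ := by
          rw [norm_smul, norm_smul, Real.norm_of_nonneg ha, Real.norm_of_nonneg hb]
        _ ≤ a * R + b * R := by gcongr
        _ = R := by rw [← add_mul, hab, one_mul])
    (left_mem_segment ℝ _ _) (right_mem_segment ℝ _ _)
  rw [e]
  simp only [← smul_sub, norm_smul, norm_pow, norm_norm] at key
  have e2 : x - s - (x - t) = -(s - t) := by abel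
  rwa [e2, norm_neg] at key

/-- Translation is jointly continuous in the translation parameter and the function. -/
theorem continuous_compSubConstCLM :
    Continuous fun z : V × 𝓢(V, ℂ) => compSubConstCLM ℂ z.1 z.2 := by
  rw [continuous_iff_continuousAt]
  rintro ⟨s₀, φ₀⟩
  have hsup : ∀ m : ℕ × ℕ, Continuous fun φ : 𝓢(V, ℂ) =>
      ((Finset.Iic m).sup (schwartzSeminormFamily ℂ V ℂ)) φ :=
    fun m => Seminorm.continuous_finsetSup fun i _ =>
      (schwartz_withSeminorms ℂ V ℂ).continuous_seminorm i
  refine ((schwartz_withSeminorms ℂ V ℂ).tendsto_nhds _ _).mpr fun ⟨k, l⟩ ε hε => ?_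
  have hlim : Tendsto (fun z : V × 𝓢(V, ℂ) =>
      (1 + ‖z.1‖) ^ k * (2 ^ k * ((Finset.Iic (k, l)).sup (schwartzSeminormFamily ℂ V ℂ))
        (z.2 - φ₀)) +
      (1 + (‖z.1‖ + ‖s₀‖)) ^ k *
        (2 ^ k * ((Finset.Iic (k, l + 1)).sup (schwartzSeminormFamily ℂ V ℂ)) φ₀) *
        ‖z.1 - s₀‖) (𝓝 (s₀, φ₀)) (𝓝 0) := by
    have hc : Continuous (fun z : V × 𝓢(V, ℂ) =>
      (1 + ‖z.1‖) ^ k * (2 ^ k * ((Finset.Iic (k, l)).sup (schwartzSeminormFamily ℂ V ℂ))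
        (z.2 - φ₀)) +
      (1 + (‖z.1‖ + ‖s₀‖)) ^ k *
        (2 ^ k * ((Finset.Iic (k, l + 1)).sup (schwartzSeminormFamily ℂ V ℂ)) φ₀) *
        ‖z.1 - s₀‖) := by
      have := (hsup (k, l)).comp (continuous_snd.sub continuous_const :
        Continuous fun z : V × 𝓢(V, ℂ) => z.2 - φ₀)
      simp only [Function.comp_def] at this
      fun_prop
    simpa using hc.tendsto (s₀, φ₀)
  filter_upwards [hlim.eventually (gt_mem_nhds hε)] with z hz
  refine lt_of_le_of_lt ?_ hz
  -- The function and the translation parameter are varied one at a time.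
  have e : compSubConstCLM ℂ z.1 z.2 - compSubConstCLM ℂ s₀ φ₀ =
      compSubConstCLM ℂ z.1 (z.2 - φ₀) + (compSubConstCLM ℂ z.1 φ₀ - compSubConstCLM ℂ s₀ φ₀) := by
    rw [map_sub]; abel
  rw [e]
  refine (map_add_le_add _ _ _).trans (add_le_add ?_ ?_)
  · exact seminorm_compSubConstCLM_le k l le_rfl _
  · exact seminorm_compSubConstCLM_sub_le k l (le_add_of_nonneg_right (norm_nonneg _))
      (le_add_of_nonneg_left (norm_nonneg _)) φ₀

/-- A family of Schwartz functions whose seminorms are bounded by powers of the weight `ω`. -/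
def PolyBounded {Z : Type*} (ω : Z → ℝ) (u : Z → 𝓢(V, ℂ)) : Prop :=
  ∀ k l, ∃ (C : ℝ) (N : ℕ), 0 ≤ C ∧ ∀ z, SchwartzMap.seminorm ℂ k l (u z) ≤ C * ω z ^ N

namespace PolyBounded

variable {Z : Type*} {ω : Z → ℝ} {u : Z → 𝓢(V, ℂ)}

theorem const (φ : 𝓢(V, ℂ)) : PolyBounded ω fun _ => φ := fun k l =>
  ⟨SchwartzMap.seminorm ℂ k l φ, 0, apply_nonneg _ _, fun z => by simp⟩

theorem finset_sup (hω : ∀ z, 1 ≤ ω z) (hu : PolyBounded ω u) (S : Finset (ℕ × ℕ)) :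
    ∃ (C : ℝ) (N : ℕ), 0 ≤ C ∧ ∀ z, (S.sup (schwartzSeminormFamily ℂ V ℂ)) (u z) ≤ C * ω z ^ N := by
  choose C N hC h using fun i : ℕ × ℕ => hu i.1 i.2
  refine ⟨∑ i ∈ S, C i, ∑ i ∈ S, N i, Finset.sum_nonneg fun i _ => hC i, fun z => ?_⟩
  have h0 : 0 ≤ ω z := zero_le_one.trans (hω z)
  refine Seminorm.finset_sup_apply_le
    (mul_nonneg (Finset.sum_nonneg fun i _ => hC i) (pow_nonneg h0 _)) fun i hi => ?_
  refine (h i z).trans (mul_le_mul (Finset.single_le_sum (fun i _ => hC i) hi)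
    (pow_le_pow_right₀ (hω z) (Finset.single_le_sum (f := N) (fun i _ => Nat.zero_le _) hi))
    (pow_nonneg h0 _) (Finset.sum_nonneg fun i _ => hC i))

theorem clm (hω : ∀ z, 1 ≤ ω z) (hu : PolyBounded ω u) (L : 𝓢(V, ℂ) →L[ℂ] 𝓢(V, ℂ)) :
    PolyBounded ω fun z => L (u z) := by
  intro k l
  let q : Seminorm ℂ 𝓢(V, ℂ) := (SchwartzMap.seminorm ℂ k l).comp (L : 𝓢(V, ℂ) →ₗ[ℂ] 𝓢(V, ℂ))
  have hq : Continuous q :=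
    ((schwartz_withSeminorms ℂ V ℂ).continuous_seminorm (k, l)).comp L.continuous
  obtain ⟨S, C, -, hC⟩ := Seminorm.bound_of_continuous (schwartz_withSeminorms ℂ V ℂ) q hq
  obtain ⟨C', N, hC', h⟩ := hu.finset_sup hω S
  refine ⟨C * C', N, mul_nonneg C.2 hC', fun z => (hC (u z)).trans ?_⟩
  rw [mul_assoc]
  exact mul_le_mul_of_nonneg_left (h z) C.2

theorem compSubConst (hω : ∀ z, 1 ≤ ω z) (hu : PolyBounded ω u) {s : Z → V}
    (hs : ∀ z, 1 + ‖s z‖ ≤ ω z) : PolyBounded ω fun z => compSubConstCLM ℂ (s z) (u z) := by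
  intro k l
  obtain ⟨C, N, hC, h⟩ := hu.finset_sup hω (Finset.Iic (k, l))
  refine ⟨2 ^ k * C, k + N, by positivity, fun z => ?_⟩
  have h0 : 0 ≤ ω z := zero_le_one.trans (hω z)
  refine (seminorm_compSubConstCLM_le k l le_rfl (u z)).trans ?_
  calc _ ≤ ω z ^ k * (2 ^ k * (C * ω z ^ N)) := by
        gcongr
        · exact hs z
        · exact h z
    _ = _ := by ring

end PolyBounded

end Translation

section Modulation

variable {V : Type} [NormedAddCommGroup V] [InnerProductSpace ℝ V] [FiniteDimensional ℝ V]
  [MeasurableSpace V] [BorelSpace V]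

/-- The time-frequency shift `φ ↦ e^{2 π i ⟨w, x⟩} φ(x - s)`. -/
noncomputable def timeFreqShift (s w : V) : 𝓢(V, ℂ) →L[ℂ] 𝓢(V, ℂ) :=
  (FourierTransform.fourierInvCLM ℂ 𝓢(V, ℂ)).comp ((compSubConstCLM ℂ w).comp
    ((FourierTransform.fourierCLM ℂ 𝓢(V, ℂ)).comp (compSubConstCLM ℂ s)))

theorem timeFreqShift_apply (s w : V) (φ : 𝓢(V, ℂ)) (x : V) :
    timeFreqShift s w φ x =
      Complex.exp (2 * Real.pi * (inner ℝ w x : ℝ) * Complex.I) * φ (x - s) := by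
  have key : ∀ ψ : 𝓢(V, ℂ), 𝓕⁻ (compSubConstCLM ℂ w (𝓕 ψ)) x =
      Complex.exp (2 * Real.pi * (inner ℝ w x : ℝ) * Complex.I) * ψ x := by
    intro ψ
    have h1 : ψ x = 𝓕⁻ (𝓕 ψ) x := by rw [FourierTransform.fourierInv_fourier_eq]
    rw [h1, fourierInv_coe, fourierInv_coe, Real.fourierInv_eq', Real.fourierInv_eq',
      ← integral_const_mul, ← integral_add_right_eq_self _ w]
    refine integral_congr_ae (Eventually.of_forall fun v => ?_)
    simp only [compSubConstCLM_apply, add_sub_cancel_right, smul_eq_mul, inner_add_left]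
    rw [← mul_assoc, ← Complex.exp_add]
    congr 2
    push_cast
    ring
  exact (key _).trans (by exact congrArg _ (compSubConstCLM_apply φ s x))

/-- Modulation is translation conjugated by the Fourier transform, so joint continuity of
translations suffices. The polynomial bounds below follow from those for translations in the same
way. -/
theorem continuous_timeFreqShift (φ : 𝓢(V, ℂ)) :
    Continuous fun z : V × V => timeFreqShift z.1 z.2 φ := by
  have h1 : Continuous fun z : V × V => compSubConstCLM ℂ z.1 φ :=
    continuous_compSubConstCLM.comp (continuous_fst.prodMk continuous_const)
  have h2 := (FourierTransform.fourierCLM ℂ 𝓢(V, ℂ)).continuous.comp h1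
  exact (FourierTransform.fourierInvCLM ℂ 𝓢(V, ℂ)).continuous.comp
    (continuous_compSubConstCLM.comp (continuous_snd.prodMk h2))

theorem polyBounded_timeFreqShift (φ : 𝓢(V, ℂ)) :
    PolyBounded (fun z : V × V => (1 + ‖z.1‖) * (1 + ‖z.2‖))
      fun z => timeFreqShift z.1 z.2 φ := by
  have hω : ∀ z : V × V, 1 ≤ (1 + ‖z.1‖) * (1 + ‖z.2‖) := fun z =>
    one_le_mul_of_one_le_of_one_le (by simp) (by simp)
  have h1 := (PolyBounded.const (ω := fun z : V × V => (1 + ‖z.1‖) * (1 + ‖z.2‖)) φ).compSubConst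
    hω (s := fun z => z.1) fun z => le_mul_of_one_le_right (by positivity) (by simp)
  exact (((h1.clm hω (FourierTransform.fourierCLM ℂ 𝓢(V, ℂ))).compSubConst hω (s := fun z => z.2)
    fun z => le_mul_of_one_le_left (by positivity) (by simp))).clm hω
      (FourierTransform.fourierInvCLM ℂ 𝓢(V, ℂ))

end Modulation

end SchwartzMap

end TimeFrequencyShifts

/-! ### The short-time Fourier transform and change of window -/

section ShortTimeFourierTransform

namespace SchwartzMap

theorem one_add_norm_pow_mul_norm_le {V : Type} [NormedAddCommGroup V] [NormedSpace ℝ V]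
    (φ : 𝓢(V, ℂ)) (N : ℕ) : ∃ C : ℝ, 0 ≤ C ∧ ∀ x, (1 + ‖x‖) ^ N * ‖φ x‖ ≤ C := by
  refine ⟨2 ^ N * ((Finset.Iic (N, 0)).sup fun m => SchwartzMap.seminorm ℂ m.1 m.2) φ,
    by positivity, fun x => ?_⟩
  simpa using one_add_le_sup_seminorm_apply (𝕜 := ℂ) (m := (N, 0)) le_rfl le_rfl φ x

variable {V : Type} [NormedAddCommGroup V] [InnerProductSpace ℝ V] [FiniteDimensional ℝ V]
  [MeasurableSpace V] [BorelSpace V]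

theorem integrable_inv_one_add_norm_pow :
    Integrable (fun x : V => ((1 + ‖x‖) ^ (Module.finrank ℝ V + 1))⁻¹) := by
  have h := integrable_one_add_norm (E := V) (μ := volume) (r := (Module.finrank ℝ V + 1 : ℕ))
    (by push_cast; linarith)
  refine h.congr (Eventually.of_forall fun x => ?_)
  simp only
  rw [Real.rpow_neg (by positivity), Real.rpow_natCast]

theorem integrable_prod_inv_one_add_norm_pow :
    Integrable (fun z : V × V => ((1 + ‖z.1‖) ^ (Module.finrank ℝ V + 1))⁻¹ *
      ((1 + ‖z.2‖) ^ (Module.finrank ℝ V + 1))⁻¹) (volume.prod volume) :=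
  integrable_inv_one_add_norm_pow.mul_prod integrable_inv_one_add_norm_pow

/-- The short-time Fourier transform `∫ γ(x - s) h(x) e^{-2 π i ⟨w, x⟩} dx`, as a Schwartz function
of `w`. -/
noncomputable def stft (γ h : 𝓢(V, ℂ)) (s : V) : 𝓢(V, ℂ) :=
  𝓕 (SchwartzMap.pairing (ContinuousLinearMap.mul ℂ ℂ) (compSubConstCLM ℂ s γ) h)

theorem stft_eq_integral (γ h : 𝓢(V, ℂ)) (s w : V) : stft γ h s w =
    ∫ x, Complex.exp (((-2 * Real.pi * inner ℝ x w : ℝ) : ℂ) * Complex.I) * (γ (x - s) * h x) := by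
  rw [stft, fourier_coe, Real.fourier_eq']
  simp

theorem continuous_stft (γ h : 𝓢(V, ℂ)) : Continuous fun z : V × V => stft γ h z.1 z.2 := by
  have h1 : Continuous fun s : V => stft γ h s :=
    (FourierTransform.fourierCLM ℂ 𝓢(V, ℂ)).continuous.comp
      ((SchwartzMap.pairing_continuous_left (ContinuousLinearMap.mul ℂ ℂ) h).comp
        (continuous_compSubConstCLM.comp (continuous_id.prodMk continuous_const)))
  -- Evaluation at `w` is translation by `-w` followed by evaluation at `0`, which makes joint
  -- continuity available.
  have h2 : Continuous fun z : V × V => compSubConstCLM ℂ (-z.2) (stft γ h z.1) 0 :=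
    (continuous_eval_const 0).comp
      (continuous_compSubConstCLM.comp (continuous_snd.neg.prodMk (h1.comp continuous_fst)))
  simpa using h2

/-- The Fourier transform turns the derivative of the product `γ(· - s) h` into multiplication by
`2πi⟨w, m⟩`. This trades a power of `w` for derivatives of the two functions. -/
theorem stft_lineDerivOp (γ h : 𝓢(V, ℂ)) (m s w : V) :
    (2 * Real.pi * Complex.I) * (inner ℝ w m : ℝ) * stft γ h s w =
      stft (∂_{m} γ) h s w + stft γ (∂_{m} h) s w := by
  have e : ∂_{m} (SchwartzMap.pairing (ContinuousLinearMap.mul ℂ ℂ) (compSubConstCLM ℂ s γ) h) =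
      SchwartzMap.pairing (ContinuousLinearMap.mul ℂ ℂ) (compSubConstCLM ℂ s (∂_{m} γ)) h +
      SchwartzMap.pairing (ContinuousLinearMap.mul ℂ ℂ) (compSubConstCLM ℂ s γ) (∂_{m} h) := by
    ext x
    have h1 : HasFDerivAt (fun x => γ (x - s)) (fderiv ℝ γ (x - s)) x := by
      have := (γ.hasFDerivAt (x - s)).comp x ((hasFDerivAt_id x).sub_const s)
      simpa [Function.comp_def] using this
    have h2 := h1.mul (h.hasFDerivAt x)
    have e1 : (SchwartzMap.pairing (ContinuousLinearMap.mul ℂ ℂ) (compSubConstCLM ℂ s γ) h :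
        V → ℂ) = fun x => γ (x - s) * h x := by
      ext y; simp
    rw [lineDerivOp_apply_eq_fderiv, e1]
    have h3 := h2.fderiv
    simp only [Pi.mul_def] at h3
    rw [h3]
    simp [lineDerivOp_apply_eq_fderiv]
    ring
  have h1 := congrArg (fun φ : 𝓢(V, ℂ) => 𝓕 φ w) e
  simp only [fourier_lineDerivOp_eq, FourierTransform.fourier_add] at h1
  refine Eq.trans ?_ h1
  simp only [smul_apply, smul_eq_mul]
  rw [smulLeftCLM_apply_apply (Function.hasTemperateGrowth_inner_left m)]
  simp [stft, mul_assoc]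

omit [MeasurableSpace V] [BorelSpace V] in
theorem norm_le_sum_abs_inner (w : V) :
    ‖w‖ ≤ ∑ i, |inner ℝ w (stdOrthonormalBasis ℝ V i)| := by
  conv_lhs => rw [← (stdOrthonormalBasis ℝ V).sum_repr' w]
  refine (norm_sum_le _ _).trans (le_of_eq (Finset.sum_congr rfl fun i _ => ?_))
  rw [norm_smul, (stdOrthonormalBasis ℝ V).norm_eq_one, mul_one, Real.norm_eq_abs,
    real_inner_comm]

/-- The weight splits by `1 + ‖s‖ ≤ (1 + ‖x - s‖)(1 + ‖x‖)`, and the decay of `γ` and of `h` absorbs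
one factor each; `dim V + 1` further powers from `h` make the integral converge. -/
theorem one_add_norm_pow_mul_norm_stft_le_aux (γ h : 𝓢(V, ℂ)) (M : ℕ) :
    ∃ C : ℝ, 0 ≤ C ∧ ∀ s w, (1 + ‖s‖) ^ M * ‖stft γ h s w‖ ≤ C := by
  obtain ⟨C₁, hC₁, h₁⟩ := one_add_norm_pow_mul_norm_le γ M
  obtain ⟨C₂, hC₂, h₂⟩ := one_add_norm_pow_mul_norm_le h (M + (Module.finrank ℝ V + 1))
  refine ⟨∫ x : V, C₁ * C₂ * ((1 + ‖x‖) ^ (Module.finrank ℝ V + 1))⁻¹,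
    integral_nonneg fun x => by positivity, fun s w => ?_⟩
  rw [stft_eq_integral]
  have hs : 0 < (1 + ‖s‖) ^ M := by positivity
  have e : (1 + ‖s‖) ^ M * ‖∫ x, Complex.exp (((-2 * Real.pi * inner ℝ x w : ℝ) : ℂ) * Complex.I) *
      (γ (x - s) * h x)‖ = ‖∫ x, ((1 + ‖s‖) ^ M) • (Complex.exp
        (((-2 * Real.pi * inner ℝ x w : ℝ) : ℂ) * Complex.I) * (γ (x - s) * h x))‖ := by
    rw [integral_smul, norm_smul, Real.norm_of_nonneg hs.le]
  rw [e]
  refine norm_integral_le_of_norm_le (integrable_inv_one_add_norm_pow.const_mul _)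
    (Eventually.of_forall fun x => ?_)
  rw [norm_smul, Real.norm_of_nonneg hs.le, norm_mul, Complex.norm_exp_ofReal_mul_I, one_mul,
    norm_mul]
  have hx : 1 + ‖s‖ ≤ (1 + ‖x - s‖) * (1 + ‖x‖) := by
    have h3 : ‖s‖ ≤ ‖x‖ + ‖x - s‖ := by
      have := norm_sub_le x (x - s)
      simpa using this
    nlinarith [mul_nonneg (norm_nonneg x) (norm_nonneg (x - s))]
  rw [← div_eq_mul_inv, le_div_iff₀ (by positivity)]
  calc (1 + ‖s‖) ^ M * (‖γ (x - s)‖ * ‖h x‖) * (1 + ‖x‖) ^ (Module.finrank ℝ V + 1)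
      ≤ ((1 + ‖x - s‖) * (1 + ‖x‖)) ^ M * (‖γ (x - s)‖ * ‖h x‖) *
        (1 + ‖x‖) ^ (Module.finrank ℝ V + 1) := by gcongr
    _ = ((1 + ‖x - s‖) ^ M * ‖γ (x - s)‖) *
        ((1 + ‖x‖) ^ (M + (Module.finrank ℝ V + 1)) * ‖h x‖) := by
      rw [mul_pow, pow_add]; ring
    _ ≤ C₁ * C₂ := mul_le_mul (h₁ _) (h₂ _) (by positivity) hC₁

/-- The short-time Fourier transform of Schwartz functions is rapidly decreasing. -/
theorem one_add_norm_pow_mul_norm_stft_le (M N : ℕ) : ∀ γ h : 𝓢(V, ℂ),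
    ∃ C : ℝ, 0 ≤ C ∧ ∀ s w, (1 + ‖s‖) ^ M * ((1 + ‖w‖) ^ N * ‖stft γ h s w‖) ≤ C := by
  -- Each step multiplies by `1 + ‖w‖`, with `‖w‖` bounded by the sum of its coordinates. Both
  -- functions stay universally quantified because `stft_lineDerivOp` replaces them by derivatives.
  induction N with
  | zero => simpa using fun γ h => one_add_norm_pow_mul_norm_stft_le_aux γ h M
  | succ N ih =>
    intro γ h
    obtain ⟨C, hC, hb⟩ := ih γ h
    choose C₁ hC₁ hb₁ using fun i => ih (∂_{(stdOrthonormalBasis ℝ V i)} γ) h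
    choose C₂ hC₂ hb₂ using fun i => ih γ (∂_{(stdOrthonormalBasis ℝ V i)} h)
    refine ⟨C + ∑ i, (C₁ i + C₂ i),
      add_nonneg hC (Finset.sum_nonneg fun i _ => add_nonneg (hC₁ i) (hC₂ i)), fun s w => ?_⟩
    have hi : ∀ i, |inner ℝ w (stdOrthonormalBasis ℝ V i)| * ‖stft γ h s w‖ ≤
        ‖stft (∂_{(stdOrthonormalBasis ℝ V i)} γ) h s w‖ +
          ‖stft γ (∂_{(stdOrthonormalBasis ℝ V i)} h) s w‖ := by
      intro i
      refine le_trans ?_ (norm_add_le _ _)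
      rw [← stft_lineDerivOp, norm_mul, norm_mul, Complex.norm_real, Real.norm_eq_abs]
      have h1 : (1 : ℝ) ≤ ‖(2 * Real.pi * Complex.I : ℂ)‖ := by
        simp only [norm_mul, Complex.norm_I, Complex.norm_real, mul_one, Complex.norm_ofNat,
          Real.norm_of_nonneg Real.pi_pos.le]
        linarith [Real.pi_gt_three]
      rw [mul_assoc]
      exact le_mul_of_one_le_left (by positivity) h1
    calc (1 + ‖s‖) ^ M * ((1 + ‖w‖) ^ (N + 1) * ‖stft γ h s w‖)
        = (1 + ‖s‖) ^ M * ((1 + ‖w‖) ^ N * ‖stft γ h s w‖) +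
          (1 + ‖s‖) ^ M * (1 + ‖w‖) ^ N * (‖w‖ * ‖stft γ h s w‖) := by ring
      _ ≤ C + (1 + ‖s‖) ^ M * (1 + ‖w‖) ^ N *
          ((∑ i, |inner ℝ w (stdOrthonormalBasis ℝ V i)|) * ‖stft γ h s w‖) := by
        gcongr
        · exact hb s w
        · exact norm_le_sum_abs_inner w
      _ = C + ∑ i, (1 + ‖s‖) ^ M * (1 + ‖w‖) ^ N *
          (|inner ℝ w (stdOrthonormalBasis ℝ V i)| * ‖stft γ h s w‖) := by
        rw [Finset.sum_mul, Finset.mul_sum]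
      _ ≤ C + ∑ i, (C₁ i + C₂ i) := by
        refine add_le_add le_rfl (Finset.sum_le_sum fun i _ => ?_)
        calc _ ≤ (1 + ‖s‖) ^ M * (1 + ‖w‖) ^ N *
            (‖stft (∂_{(stdOrthonormalBasis ℝ V i)} γ) h s w‖ +
              ‖stft γ (∂_{(stdOrthonormalBasis ℝ V i)} h) s w‖) := by
              exact mul_le_mul_of_nonneg_left (hi i) (by positivity)
          _ = (1 + ‖s‖) ^ M * ((1 + ‖w‖) ^ N *
                ‖stft (∂_{(stdOrthonormalBasis ℝ V i)} γ) h s w‖) +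
              (1 + ‖s‖) ^ M * ((1 + ‖w‖) ^ N *
                ‖stft γ (∂_{(stdOrthonormalBasis ℝ V i)} h) s w‖) := by ring
          _ ≤ C₁ i + C₂ i := add_le_add (hb₁ i s w) (hb₂ i s w)

/-- Products of the short-time Fourier transform with functions of polynomial growth are
integrable. -/
theorem integrable_pow_mul_norm_stft (γ h : 𝓢(V, ℂ)) (N : ℕ) :
    Integrable (fun z : V × V => ((1 + ‖z.1‖) * (1 + ‖z.2‖)) ^ N * ‖stft γ h z.1 z.2‖)
      (volume.prod volume) := by
  obtain ⟨C, hC, hb⟩ := one_add_norm_pow_mul_norm_stft_le (N + (Module.finrank ℝ V + 1))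
    (N + (Module.finrank ℝ V + 1)) γ h
  refine ((integrable_prod_inv_one_add_norm_pow (V := V)).const_mul C).mono' ?_
    (Eventually.of_forall fun z => ?_)
  · refine Continuous.aestronglyMeasurable ?_
    have := continuous_stft γ h
    fun_prop
  · rw [Real.norm_of_nonneg (by positivity), ← mul_inv, ← div_eq_mul_inv,
      le_div_iff₀ (by positivity)]
    refine le_trans (le_of_eq ?_) (hb z.1 z.2)
    rw [mul_pow, pow_add, pow_add]
    ring

theorem integrable_stft (γ h : 𝓢(V, ℂ)) :
    Integrable (fun z : V × V => stft γ h z.1 z.2) (volume.prod volume) := by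
  have := integrable_pow_mul_norm_stft γ h 0
  simp only [pow_zero, one_mul] at this
  exact (integrable_norm_iff (continuous_stft γ h).aestronglyMeasurable).mp this

theorem norm_timeFreqShift_apply (s w : V) (φ : 𝓢(V, ℂ)) (x : V) :
    ‖timeFreqShift s w φ x‖ = ‖φ (x - s)‖ := by
  rw [timeFreqShift_apply, norm_mul]
  have := Complex.norm_exp_ofReal_mul_I (2 * Real.pi * inner ℝ w x)
  push_cast at this
  rw [this, one_mul]

/-- The inversion formula for the short-time Fourier transform. -/
theorem integral_stft_mul_timeFreqShift (γ g h : 𝓢(V, ℂ)) (x : V) :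
    ∫ z : V × V, stft γ h z.1 z.2 * timeFreqShift z.1 z.2 g x ∂(volume.prod volume) =
      (∫ y, γ y * g y) * h x := by
  have hint : Integrable (fun z : V × V => stft γ h z.1 z.2 * timeFreqShift z.1 z.2 g x)
      (volume.prod volume) := by
    refine ((integrable_stft γ h).norm.mul_const (SchwartzMap.seminorm ℂ 0 0 g)).mono'
      ((continuous_stft γ h).mul ((continuous_eval_const x).comp
        (continuous_timeFreqShift g))).aestronglyMeasurable (Eventually.of_forall fun z => ?_)
    rw [norm_mul, norm_timeFreqShift_apply]
    gcongr
    exact norm_le_seminorm ℂ g _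
  rw [integral_prod _ hint]
  -- For fixed `s` the integral over `w` is Fourier inversion at `x`; the remaining integral over
  -- `s` is `∫ γ g` after the substitution `y = x - s`.
  have hin : ∀ s, ∫ w, stft γ h s w * timeFreqShift s w g x = γ (x - s) * g (x - s) * h x := by
    intro s
    have h1 : 𝓕⁻ (stft γ h s) x = γ (x - s) * h x := by
      rw [stft, FourierTransform.fourierInv_fourier_eq]
      simp
    rw [fourierInv_coe, Real.fourierInv_eq'] at h1
    rw [mul_right_comm, ← h1, ← integral_mul_const]
    refine integral_congr_ae (Eventually.of_forall fun w => ?_)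
    simp only [timeFreqShift_apply, smul_eq_mul]
    push_cast
    ring
  simp only [hin]
  rw [integral_mul_const, integral_sub_left_eq_self (fun y => γ y * g y) volume x]

/-- The inversion formula of the short-time Fourier transform, tested against a tempered
distribution. -/
theorem integral_stft_mul_apply_timeFreqShift (f : 𝓢'(V, ℂ)) (γ g h : 𝓢(V, ℂ)) :
    (∫ y, γ y * g y) * f h =
      ∫ z : V × V, stft γ h z.1 z.2 * f (timeFreqShift z.1 z.2 g) ∂(volume.prod volume) := by
  have key := TemperedDistribution.apply_eq_integral (ν := (volume.prod volume : Measure (V × V))) f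
    (u := fun z : V × V => stft γ h z.1 z.2 • timeFreqShift z.1 z.2 g)
    (h := (∫ y, γ y * g y) • h) ((continuous_stft γ h).smul (continuous_timeFreqShift g))
    (fun k l => by
      -- The seminorms of the shifts grow polynomially, and the rapid decay of the short-time
      -- Fourier transform compensates for this.
      obtain ⟨C, N, hC, hb⟩ := polyBounded_timeFreqShift g k l
      refine ((integrable_pow_mul_norm_stft γ h N).const_mul C).mono'
        (((schwartz_withSeminorms ℝ V ℂ).continuous_seminorm (k, l)).comp
          ((continuous_stft γ h).smul (continuous_timeFreqShift g))).aestronglyMeasurable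
        (Eventually.of_forall fun z => ?_)
      rw [Real.norm_of_nonneg (apply_nonneg _ _)]
      change SchwartzMap.seminorm ℂ k l _ ≤ _
      rw [map_smul_eq_mul]
      calc ‖stft γ h z.1 z.2‖ * SchwartzMap.seminorm ℂ k l (timeFreqShift z.1 z.2 g)
          ≤ ‖stft γ h z.1 z.2‖ * (C * ((1 + ‖z.1‖) * (1 + ‖z.2‖)) ^ N) := by
            gcongr
            exact hb z
        _ = _ := by ring)
    (fun x => by
      simp only [smul_apply, smul_eq_mul]
      exact (integral_stft_mul_timeFreqShift γ g h x).symm)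
  simpa using key

/-- Substituting `x + s₀` for `x` leaves only the constant phase `e^{-2πi⟨s₀, w - w₀⟩}`. This
covariance is what gives the change of window its convolution form. -/
theorem norm_stft_timeFreqShift (γ g : 𝓢(V, ℂ)) (s₀ w₀ s w : V) :
    ‖stft γ (timeFreqShift s₀ w₀ g) s w‖ = ‖stft γ g (s - s₀) (w - w₀)‖ := by
  rw [stft_eq_integral, stft_eq_integral, ← integral_add_right_eq_self _ s₀]
  have e : ∀ x, Complex.exp (((-2 * Real.pi * inner ℝ (x + s₀) w : ℝ) : ℂ) * Complex.I) *
      (γ (x + s₀ - s) * timeFreqShift s₀ w₀ g (x + s₀)) =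
      Complex.exp (((-2 * Real.pi * inner ℝ s₀ (w - w₀) : ℝ) : ℂ) * Complex.I) *
      (Complex.exp (((-2 * Real.pi * inner ℝ x (w - w₀) : ℝ) : ℂ) * Complex.I) *
      (γ (x - (s - s₀)) * g x)) := by
    intro x
    have e1 : x - (s - s₀) = x + s₀ - s := by abel
    rw [timeFreqShift_apply, add_sub_cancel_right, e1, ← mul_assoc (Complex.exp _) (Complex.exp _),
      ← Complex.exp_add]
    have e2 : ∀ a b c d G : ℂ, a + b = c → Complex.exp a * (d * (Complex.exp b * G)) =
        Complex.exp c * (d * G) := by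
      intro a b c d G h
      rw [← h, Complex.exp_add]; ring
    apply e2
    simp only [inner_add_left, inner_sub_right, inner_add_right, real_inner_comm w₀]
    push_cast
    ring
  simp only [e]
  rw [integral_const_mul, norm_mul, Complex.norm_exp_ofReal_mul_I, one_mul]

/-- Change of window: the matrix coefficient for one window is dominated by a convolution of the
matrix coefficient for another window with an integrable kernel. -/
theorem enorm_apply_timeFreqShift_le (f : 𝓢'(V, ℂ)) (γ g g' : 𝓢(V, ℂ)) (z₀ : V × V) :
    ‖∫ y, γ y * g y‖ₑ * ‖f (timeFreqShift z₀.1 z₀.2 g')‖ₑ ≤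
      ∫⁻ z : V × V, ‖stft γ g' (z.1 - z₀.1) (z.2 - z₀.2)‖ₑ * ‖f (timeFreqShift z.1 z.2 g)‖ₑ
        ∂(volume.prod volume) := by
  rw [← enorm_mul, integral_stft_mul_apply_timeFreqShift]
  refine (enorm_integral_le_lintegral_enorm _).trans (le_of_eq (lintegral_congr fun z => ?_))
  rw [enorm_mul]
  congr 1
  rw [← ofReal_norm, ← ofReal_norm, norm_stft_timeFreqShift]

end SchwartzMap

end ShortTimeFourierTransform

/-! ### Minkowski's integral inequality -/

section MinkowskiIntegralInequality

variable {X Y : Type*} [MeasurableSpace X] [MeasurableSpace Y] {μ : Measure X} {ν : Measure Y}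

theorem measurable_eLpNorm_section [SFinite μ] {f : X → Y → ℝ≥0∞}
    (hf : Measurable (Function.uncurry f)) (p : ℝ≥0∞) :
    Measurable fun y => eLpNorm (fun x => f x y) p μ := by
  by_cases hp0 : p = 0
  · simp [hp0]
  by_cases hp : p = ∞
  · subst hp
    refine measurable_of_Iic fun c => ?_
    -- The essential supremum is at most `c` exactly when the section of `{f > c}` is null, and the
    -- measure of a section is measurable in `y`.
    have e : (fun y => eLpNorm (fun x => f x y) ∞ μ) ⁻¹' Set.Iic c =
        {y | μ ((fun x => (x, y)) ⁻¹' {z : X × Y | c < f z.1 z.2}) = 0} := by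
      ext y
      simp only [Set.mem_preimage, Set.mem_Iic, Set.mem_ofPred_eq, eLpNorm_exponent_top]
      constructor
      · intro h
        have h1 := enorm_ae_le_eLpNormEssSup (fun x => f x y) μ
        refine measure_mono_null (fun x hx => ?_) (ae_iff.mp h1)
        simp only [Set.mem_ofPred_eq, not_le, enorm_eq_self]
        exact h.trans_lt hx
      · intro h
        refine eLpNormEssSup_le_of_ae_enorm_bound (ae_iff.mpr ?_)
        simpa using h
    rw [e]
    exact (measurable_measure_prodMk_right (measurableSet_lt measurable_const hf))
      (measurableSet_singleton 0)
  · simp only [eLpNorm_eq_lintegral_rpow_enorm_toReal hp0 hp, enorm_eq_self]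
    exact ((hf.pow_const p.toReal).lintegral_prod_left').pow_const _

/-- Write `S ^ p = S ^ (p - 1) * ∫ f`, exchange the integrals, apply Hölder in `x` and divide by the
power of `∫ S ^ p` on the right. The division needs a finite integral, so one factor `S` is kept and
the others are replaced by bounded truncations `G n` supported on sets of finite measure; monotone
convergence removes the truncation. -/
theorem lintegral_rpow_lintegral_le [SigmaFinite μ] [SFinite ν] {f : X → Y → ℝ≥0∞}
    (hf : Measurable (Function.uncurry f)) {p : ℝ} (hp : 1 < p) :
    (∫⁻ x, (∫⁻ y, f x y ∂ν) ^ p ∂μ) ^ (1 / p) ≤ ∫⁻ y, (∫⁻ x, f x y ^ p ∂μ) ^ (1 / p) ∂ν := by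
  set S : X → ℝ≥0∞ := fun x => ∫⁻ y, f x y ∂ν with hS
  set A : ℝ≥0∞ := ∫⁻ y, (∫⁻ x, f x y ^ p ∂μ) ^ (1 / p) ∂ν with hA
  have hp0 : 0 < p := zero_lt_one.trans hp
  have hSm : Measurable S := hf.lintegral_prod_right'
  let G : ℕ → X → ℝ≥0∞ := fun n => (spanningSets μ n).indicator fun x => min (S x) n
  have hGm : ∀ n, Measurable (G n) := fun n =>
    (hSm.min measurable_const).indicator (measurableSet_spanningSets μ n)
  have hGS : ∀ n x, G n x ≤ S x := fun n x =>
    (Set.indicator_le_self' (fun _ _ => zero_le) x).trans (min_le_left _ _)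
  have hGn : ∀ n x, G n x ≤ (spanningSets μ n).indicator (fun _ => (n : ℝ≥0∞)) x := fun n x =>
    Set.indicator_le_indicator (min_le_right _ _)
  have hGmono : Monotone G := by
    intro m n hmn x
    by_cases hx : x ∈ spanningSets μ m
    · simp only [G, Set.indicator_of_mem hx,
        Set.indicator_of_mem (monotone_spanningSets μ hmn hx)]
      gcongr
    · simp only [G, Set.indicator_of_notMem hx]
      exact zero_le
  have hGsup : ∀ x, ⨆ n, G n x ^ p = S x ^ p := by
    intro x
    refine le_antisymm (iSup_le fun n => ENNReal.rpow_le_rpow (hGS n x) hp0.le) ?_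
    have h1 : Tendsto (fun n : ℕ => min (S x) (n : ℝ≥0∞)) atTop (𝓝 (S x)) := by
      simpa using (tendsto_const_nhds (x := S x)).min ENNReal.tendsto_nat_nhds_top
    obtain ⟨n₀, hn₀⟩ : ∃ n, x ∈ spanningSets μ n :=
      ⟨spanningSetsIndex μ x, mem_spanningSetsIndex μ x⟩
    have h2 : Tendsto (fun n => G n x) atTop (𝓝 (S x)) := by
      refine h1.congr' ?_
      filter_upwards [eventually_ge_atTop n₀] with n hn
      simp only [G, Set.indicator_of_mem (monotone_spanningSets μ hn hn₀)]
    exact le_of_tendsto' ((ENNReal.continuous_rpow_const.tendsto (S x)).comp h2)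
      fun n => le_iSup (fun n => G n x ^ p) n
  have hfin : ∀ n, ∫⁻ x, G n x ^ p ∂μ ≠ ∞ := by
    intro n
    have h1 : ∫⁻ x, G n x ^ p ∂μ ≤
        ∫⁻ x, (spanningSets μ n).indicator (fun _ => (n : ℝ≥0∞) ^ p) x ∂μ := by
      refine lintegral_mono fun x => ?_
      by_cases hx : x ∈ spanningSets μ n
      · have := hGn n x
        rw [Set.indicator_of_mem hx] at this ⊢
        exact ENNReal.rpow_le_rpow this hp0.le
      · simp [G, hx, hp0]
    refine ne_top_of_le_ne_top ?_ h1
    rw [lintegral_indicator_const (measurableSet_spanningSets μ n)]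
    exact ENNReal.mul_ne_top (ENNReal.rpow_ne_top_of_nonneg hp0.le (by simp))
      (measure_spanningSets_lt_top μ n).ne
  have hconj : p.HolderConjugate (Real.conjExponent p) := Real.HolderConjugate.conjExponent hp
  have hbound : ∀ n, (∫⁻ x, G n x ^ p ∂μ) ≤ A ^ p := by
    intro n
    set I := ∫⁻ x, G n x ^ p ∂μ with hI
    have h1 : I ≤ I ^ (1 / Real.conjExponent p) * A := by
      calc I ≤ ∫⁻ x, ∫⁻ y, G n x ^ (p - 1) * f x y ∂ν ∂μ := by
            refine lintegral_mono fun x => ?_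
            simp only
            rw [lintegral_const_mul _ (hf.of_uncurry_left)]
            have e : G n x ^ p = G n x ^ (p - 1) * G n x := by
              nth_rewrite 3 [← ENNReal.rpow_one (G n x)]
              rw [← ENNReal.rpow_add_of_nonneg _ _ (by linarith) zero_le_one, sub_add_cancel]
            rw [e]
            gcongr
            exact hGS n x
        _ = ∫⁻ y, ∫⁻ x, G n x ^ (p - 1) * f x y ∂μ ∂ν :=
            lintegral_lintegral_swap
              (((((hGm n).pow_const (p - 1)).comp measurable_fst).mul hf).aemeasurable)
        _ ≤ ∫⁻ y, I ^ (1 / Real.conjExponent p) * (∫⁻ x, f x y ^ p ∂μ) ^ (1 / p) ∂ν := by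
            refine lintegral_mono fun y => ?_
            have := ENNReal.lintegral_mul_le_Lp_mul_Lq μ hconj.symm
              (f := fun x => G n x ^ (p - 1)) (g := fun x => f x y)
              ((hGm n).pow_const (p - 1)).aemeasurable hf.of_uncurry_right.aemeasurable
            refine this.trans (le_of_eq ?_)
            congr 2
            rw [hI]
            refine lintegral_congr fun x => ?_
            rw [← ENNReal.rpow_mul, hconj.sub_one_mul_conj]
        _ = I ^ (1 / Real.conjExponent p) * A := by
            rw [lintegral_const_mul]
            exact ((hf.pow_const p).lintegral_prod_left').pow_const _
    by_cases hI0 : I = 0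
    · rw [hI0]; exact zero_le
    have h2 : I ^ (1 / p) ≤ A := by
      have h3 : I = I ^ (1 / Real.conjExponent p) * I ^ (1 / p) := by
        rw [← ENNReal.rpow_add _ _ hI0 (hfin n), one_div, one_div, hconj.symm.inv_add_inv_eq_one,
          ENNReal.rpow_one]
      have h4 : I ^ (1 / Real.conjExponent p) ≠ 0 := by
        simp [ENNReal.rpow_eq_zero_iff, hI0, hconj.symm.nonneg]
      have h5 : I ^ (1 / Real.conjExponent p) ≠ ∞ :=
        ENNReal.rpow_ne_top_of_nonneg (one_div_nonneg.mpr hconj.symm.nonneg) (hfin n)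
      exact (ENNReal.mul_le_mul_iff_right h4 h5).mp (h3.symm.le.trans h1)
    have := ENNReal.rpow_le_rpow h2 hp0.le
    rwa [← ENNReal.rpow_mul, one_div_mul_cancel hp0.ne', ENNReal.rpow_one] at this
  have hlim : ∫⁻ x, S x ^ p ∂μ ≤ A ^ p := by
    calc ∫⁻ x, S x ^ p ∂μ = ∫⁻ x, ⨆ n, G n x ^ p ∂μ := lintegral_congr fun x => (hGsup x).symm
      _ = ⨆ n, ∫⁻ x, G n x ^ p ∂μ := lintegral_iSup (fun n => (hGm n).pow_const p)
          fun m n hmn x => ENNReal.rpow_le_rpow (hGmono hmn x) hp0.le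
      _ ≤ A ^ p := iSup_le hbound
  have := ENNReal.rpow_le_rpow hlim (one_div_nonneg.mpr hp0.le)
  rwa [← ENNReal.rpow_mul, mul_one_div_cancel hp0.ne', ENNReal.rpow_one] at this

/-- Minkowski's integral inequality. -/
theorem eLpNorm_lintegral_le [SigmaFinite μ] [SFinite ν] {f : X → Y → ℝ≥0∞}
    (hf : Measurable (Function.uncurry f)) {p : ℝ≥0∞} (hp : 1 ≤ p) :
    eLpNorm (fun x => ∫⁻ y, f x y ∂ν) p μ ≤ ∫⁻ y, eLpNorm (fun x => f x y) p μ ∂ν := by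
  rcases eq_or_ne p ∞ with rfl | hp'
  · have hN := measurable_eLpNorm_section (μ := μ) hf ∞
    have h1 : ∀ᵐ y ∂ν, ∀ᵐ x ∂μ, f x y ≤ eLpNorm (fun x => f x y) ∞ μ :=
      Eventually.of_forall fun y => by
        simpa using enorm_ae_le_eLpNormEssSup (fun x => f x y) μ
    -- For `p = ∞` the inequality reduces to exchanging the two almost-everywhere quantifiers, which
    -- Fubini permits for a measurable set.
    have h2 : ∀ᵐ x ∂μ, ∀ᵐ y ∂ν, f x y ≤ eLpNorm (fun x => f x y) ∞ μ :=
      (Measure.ae_ae_comm (p := fun x y => f x y ≤ eLpNorm (fun x => f x y) ∞ μ)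
      (measurableSet_le hf (hN.comp measurable_snd))).mpr h1
    rw [eLpNorm_exponent_top (f := fun x => ∫⁻ y, f x y ∂ν)]
    refine eLpNormEssSup_le_of_ae_enorm_bound ?_
    filter_upwards [h2] with x hx
    exact lintegral_mono_ae hx
  · have hp0 : p ≠ 0 := (zero_lt_one.trans_le hp).ne'
    rcases eq_or_lt_of_le hp with rfl | h1
    · simp only [eLpNorm_one_eq_lintegral_enorm, enorm_eq_self]
      exact (lintegral_lintegral_swap hf.aemeasurable).le
    · simp only [eLpNorm_eq_lintegral_rpow_enorm_toReal hp0 hp', enorm_eq_self]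
      exact lintegral_rpow_lintegral_le hf
        ((ENNReal.toReal_lt_toReal ENNReal.one_ne_top hp').mpr h1)

end MinkowskiIntegralInequality

/-! ### Young's inequality for mixed norms -/

section MixedNorms

theorem eLpNorm_ennreal_const_mul {X : Type*} [MeasurableSpace X] {μ : Measure X} {c : ℝ≥0∞}
    (hc : c ≠ ∞) (f : X → ℝ≥0∞) {p : ℝ≥0∞} (hp : p ≠ 0) :
    eLpNorm (fun x => c * f x) p μ = c * eLpNorm f p μ := by
  rcases eq_or_ne p ∞ with rfl | hp'
  · simp only [eLpNorm_exponent_top, eLpNormEssSup, enorm_eq_self]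
    exact ENNReal.essSup_const_mul
  · have h0 : 0 < p.toReal := ENNReal.toReal_pos hp hp'
    simp only [eLpNorm_eq_lintegral_rpow_enorm_toReal hp hp', enorm_eq_self,
      ENNReal.mul_rpow_of_nonneg _ _ h0.le]
    rw [lintegral_const_mul' _ _ (ENNReal.rpow_ne_top_of_nonneg h0.le hc),
      ENNReal.mul_rpow_of_nonneg _ _ (one_div_nonneg.mpr h0.le), ← ENNReal.rpow_mul,
      mul_one_div_cancel h0.ne', ENNReal.rpow_one]

/-- Young's inequality for mixed norms: a function dominated by the average of the translates of `G`
with respect to a measure `ν` has mixed norm at most `ν univ` times that of `G`. -/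
theorem eLpNorm_eLpNorm_le_of_le_lintegral_add {V : Type*} [MeasurableSpace V] [AddGroup V]
    [MeasurableAdd₂ V] {μ : Measure V} [SigmaFinite μ] [μ.IsAddRightInvariant]
    {ν : Measure (V × V)} [SFinite ν] {G H : V × V → ℝ≥0∞} (hG : Measurable G)
    (hH : ∀ z, H z ≤ ∫⁻ y, G (z + y) ∂ν) {p q : ℝ≥0∞} (hp : 1 ≤ p) (hq : 1 ≤ q) :
    eLpNorm (fun η => eLpNorm (fun ξ => H (ξ, η)) p μ) q μ ≤
      ν Set.univ * eLpNorm (fun η => eLpNorm (fun ξ => G (ξ, η)) p μ) q μ := by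
  set N : V → ℝ≥0∞ := fun η => eLpNorm (fun ξ => G (ξ, η)) p μ with hN
  have hNm : Measurable N := measurable_eLpNorm_section (f := fun ξ η => G (ξ, η)) hG p
  -- Minkowski in `ξ`: invariance of `μ` removes the shift by `y.1`. A second application, in `η`,
  -- then removes `y.2` and leaves the total mass of `ν`.
  have h1 : ∀ η, eLpNorm (fun ξ => H (ξ, η)) p μ ≤ ∫⁻ y, N (η + y.2) ∂ν := by
    intro η
    refine (eLpNorm_mono_enorm (g := fun ξ => ∫⁻ y, G ((ξ, η) + y) ∂ν)
      fun ξ => by simpa using hH (ξ, η)).trans ?_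
    refine (eLpNorm_lintegral_le (μ := μ) (ν := ν)
      (f := fun ξ (y : V × V) => G ((ξ, η) + y)) ?_ hp).trans
      (le_of_eq (lintegral_congr fun y => ?_))
    · exact hG.comp ((measurable_fst.add (measurable_fst.comp measurable_snd)).prodMk
        (measurable_const.add (measurable_snd.comp measurable_snd)))
    · exact eLpNorm_comp_measurePreserving (g := fun ξ => G (ξ, η + y.2))
        (hG.comp (measurable_id.prodMk measurable_const)).aestronglyMeasurable
        (measurePreserving_add_right μ y.1)
  refine (eLpNorm_mono_enorm (g := fun η => ∫⁻ y, N (η + y.2) ∂ν)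
    fun η => by simpa using h1 η).trans ?_
  refine (eLpNorm_lintegral_le (μ := μ) (ν := ν)
    (f := fun η (y : V × V) => N (η + y.2)) ?_ hq).trans ?_
  · exact hNm.comp (measurable_fst.add (measurable_snd.comp measurable_snd))
  · have h2 : ∀ y : V × V, eLpNorm (fun η => N (η + y.2)) q μ = eLpNorm N q μ := fun y =>
      eLpNorm_comp_measurePreserving hNm.aestronglyMeasurable (measurePreserving_add_right μ y.2)
    simp only [h2, lintegral_const]
    rw [mul_comm]

end MixedNorms

namespace TwistedModulation

/-! ### Twisted operators as time-frequency shifts -/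

section Coordinates

variable {n : ℕ}

theorem rotJ_add (ξ η : R2 n) : rotJ (ξ + η) = rotJ ξ + rotJ η := by
  ext i
  cases i <;> simp [rotJ, add_comm]

theorem rotJ_smul (c : ℝ) (η : R2 n) : rotJ (c • η) = c • rotJ η := by
  ext i
  cases i <;> simp [rotJ]

theorem rotJ_rotJ (η : R2 n) : rotJ (rotJ η) = -η := by
  ext i
  cases i <;> simp [rotJ]

/-- The map `(a, b) ↦ (b, -a)` as a linear map. -/
noncomputable def rotL (n : ℕ) : R2 n →ₗ[ℝ] R2 n where
  toFun := rotJ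
  map_add' := rotJ_add
  map_smul' := rotJ_smul

theorem continuous_rotJ : Continuous (rotJ : R2 n → R2 n) :=
  (rotL n).continuous_of_finiteDimensional

/-- The position and frequency of the time-frequency shift underlying `Π_λ(ξ, η)`. -/
noncomputable def phaseCoord (lam : ℝ) (z : R2 n × R2 n) : R2 n × R2 n :=
  (z.1 + Real.tanh (lam / 2) • rotJ z.2,
    (lam / (4 * Real.pi)) • (coth (lam / 2) • z.2 - rotJ z.1))

/-- The inverse of `phaseCoord`. -/
noncomputable def phaseCoordInv (lam : ℝ) (z : R2 n × R2 n) : R2 n × R2 n :=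
  let η := (coth (lam / 2) - Real.tanh (lam / 2))⁻¹ • ((4 * Real.pi / lam) • z.2 + rotJ z.1)
  (z.1 - Real.tanh (lam / 2) • rotJ η, η)

theorem continuous_phaseCoord (lam : ℝ) : Continuous (phaseCoord (n := n) lam) := by
  have h := continuous_rotJ (n := n)
  unfold phaseCoord
  fun_prop

theorem continuous_phaseCoordInv (lam : ℝ) : Continuous (phaseCoordInv (n := n) lam) := by
  have h := continuous_rotJ (n := n)
  unfold phaseCoordInv
  fun_prop

/-- Additivity carries a convolution bound in position and frequency back to the variables `(ξ, η)`,
where the mixed norm is taken. -/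
theorem phaseCoord_add (lam : ℝ) (z y : R2 n × R2 n) :
    phaseCoord lam (z + y) = phaseCoord lam z + phaseCoord lam y := by
  simp only [phaseCoord, Prod.fst_add, Prod.snd_add, rotJ_add, Prod.mk_add_mk]
  congr 1 <;> module

/-- The difference equals `1 / (sinh cosh)`, since `cosh² - sinh² = 1`. -/
theorem coth_sub_tanh_ne_zero {lam : ℝ} (hlam : lam ≠ 0) :
    coth (lam / 2) - Real.tanh (lam / 2) ≠ 0 := by
  have hs : Real.sinh (lam / 2) ≠ 0 := by
    rw [Ne, Real.sinh_eq_zero]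
    simpa using hlam
  have hc : Real.cosh (lam / 2) ≠ 0 := (Real.cosh_pos _).ne'
  rw [coth, Real.tanh_eq_sinh_div_cosh, div_sub_div _ _ hs hc]
  refine div_ne_zero ?_ (mul_ne_zero hs hc)
  have := Real.cosh_sq (lam / 2)
  nlinarith

/-- As `J² = -1`, eliminating `ξ` gives `(4π/λ) w + J s = (coth - tanh) η`, which determines `η` and
then `ξ`. The change of window uses only this one-sided inverse. -/
theorem phaseCoord_phaseCoordInv {lam : ℝ} (hlam : lam ≠ 0) (z : R2 n × R2 n) :
    phaseCoord lam (phaseCoordInv lam z) = z := by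
  have hd := coth_sub_tanh_ne_zero hlam
  set η := (coth (lam / 2) - Real.tanh (lam / 2))⁻¹ • ((4 * Real.pi / lam) • z.2 + rotJ z.1)
    with hη
  have h1 : (coth (lam / 2) - Real.tanh (lam / 2)) • η =
      (4 * Real.pi / lam) • z.2 + rotJ z.1 := by
    rw [hη, smul_smul, mul_inv_cancel₀ hd, one_smul]
  have e : phaseCoordInv lam z = (z.1 - Real.tanh (lam / 2) • rotJ η, η) := rfl
  rw [e, phaseCoord]
  ext1
  · simp
  · simp only [sub_eq_add_neg, ← neg_smul, rotJ_add, rotJ_smul, rotJ_rotJ]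
    have h2 : coth (lam / 2) • η + -(rotJ z.1 + -Real.tanh (lam / 2) • -η) =
        (4 * Real.pi / lam) • z.2 := by
      rw [← sub_eq_iff_eq_add.mpr h1]
      module
    rw [h2, smul_smul]
    have hpi := Real.pi_ne_zero
    have : lam / (4 * Real.pi) * (4 * Real.pi / lam) = 1 := by field_simp
    rw [this, one_smul]

theorem conjS_conjS (g : 𝓢(R2 n, ℂ)) : conjS (conjS g) = g := by
  ext x
  simp [conjS_apply]

/-- The unimodular factor by which `conj (Π_λ(ξ, η) g)` differs from a time-frequency shift of
`conj g`. -/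
noncomputable def phaseFactor (lam : ℝ) (z : R2 n × R2 n) : ℂ :=
  Complex.exp (((-(lam / 2 * coth lam * inner ℝ z.1 z.2) + lam / 2 *
    (Real.tanh (lam / 2) * inner ℝ (rotJ z.2) (rotJ z.1)) : ℝ) : ℂ) * Complex.I)

theorem norm_phaseFactor (lam : ℝ) (z : R2 n × R2 n) : ‖phaseFactor lam z‖ = 1 :=
  Complex.norm_exp_ofReal_mul_I _

theorem continuous_phaseFactor (lam : ℝ) : Continuous (phaseFactor (n := n) lam) := by
  have h := continuous_rotJ (n := n)
  unfold phaseFactor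
  fun_prop

/-- Up to a unimodular constant, `conj (Π_λ(ξ, η) g)` is a time-frequency shift of `conj g`. -/
theorem conjS_repPi (lam : ℝ) (z : R2 n × R2 n) (g : 𝓢(R2 n, ℂ)) :
    conjS (repPi lam z.1 z.2 g) = phaseFactor lam z •
      SchwartzMap.timeFreqShift (phaseCoord lam z).1 (phaseCoord lam z).2 (conjS g) := by
  obtain ⟨ξ, η⟩ := z
  ext X
  have e1 : X - (ξ + Real.tanh (lam / 2) • rotJ η) = X - Real.tanh (lam / 2) • rotJ η - ξ := by
    abel
  rw [conjS_apply, smul_apply, SchwartzMap.timeFreqShift_apply, conjS_apply]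
  have e2 : repPi lam ξ η g X =
      Complex.exp (Complex.I * ((lam / 2 * coth lam * inner ℝ ξ η : ℝ) : ℂ)) *
        twistedModulation lam η (twistedTranslation lam ξ g) X := rfl
  simp only [phaseCoord, phaseFactor]
  rw [e2, twistedModulation_apply, twistedTranslation_apply, e1, symp_eq_inner]
  simp only [map_mul, ← Complex.exp_conj, Complex.conj_I, Complex.conj_ofReal, smul_eq_mul]
  have comb : ∀ (a b c d e G : ℂ), a + b + c = d + e →
      Complex.exp a * (G * Complex.exp b * Complex.exp c) =
        Complex.exp d * (Complex.exp e * G) := by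
    intro a b c d e G h
    have := congrArg Complex.exp h
    simp only [Complex.exp_add] at this
    linear_combination G * this
  apply comb
  simp only [inner_sub_left, inner_sub_right, inner_smul_left, inner_smul_right, conj_trivial,
    real_inner_comm X]
  have hpi : (Real.pi : ℂ) ≠ 0 := by exact_mod_cast Real.pi_ne_zero
  push_cast
  field_simp
  ring

end Coordinates

/-! ### Twisted matrix coefficients and window norms -/

section Coefficients

variable {n : ℕ} {lam : ℝ}

theorem matrixCoeff_eq (f : 𝓢'(R2 n, ℂ)) (g : 𝓢(R2 n, ℂ)) (z : R2 n × R2 n) :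
    matrixCoeff lam f g z = phaseFactor lam z *
      f (SchwartzMap.timeFreqShift (phaseCoord lam z).1 (phaseCoord lam z).2 (conjS g)) := by
  rw [matrixCoeff, pairing, conjS_repPi, map_smul, smul_eq_mul]

theorem enorm_matrixCoeff (f : 𝓢'(R2 n, ℂ)) (g : 𝓢(R2 n, ℂ)) (z : R2 n × R2 n) :
    ‖matrixCoeff lam f g z‖ₑ =
      ‖f (SchwartzMap.timeFreqShift (phaseCoord lam z).1 (phaseCoord lam z).2 (conjS g))‖ₑ := by
  have : ‖phaseFactor lam z‖ₑ = 1 := by rw [← ofReal_norm, norm_phaseFactor, ENNReal.ofReal_one]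
  rw [matrixCoeff_eq, enorm_mul, this, one_mul]

theorem continuous_matrixCoeff (f : 𝓢'(R2 n, ℂ)) (g : 𝓢(R2 n, ℂ)) :
    Continuous (matrixCoeff lam f g) := by
  rw [funext (matrixCoeff_eq f g)]
  exact (continuous_phaseFactor lam).mul ((f : 𝓢(R2 n, ℂ) →L[ℂ] ℂ).continuous.comp
    ((SchwartzMap.continuous_timeFreqShift (conjS g)).comp (continuous_phaseCoord lam)))

/-- This is the squared `L²` norm of `g`, the constant by which the inversion formula is divided. -/
theorem integral_mul_conjS_ne_zero {g : 𝓢(R2 n, ℂ)} (hg : g ≠ 0) :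
    ∫ x, g x * conjS g x ≠ 0 := by
  have e : ∀ x, g x * conjS g x = ((‖g x‖ ^ 2 : ℝ) : ℂ) := fun x => by
    rw [conjS_apply, Complex.mul_conj, Complex.normSq_eq_norm_sq]
  simp only [e]
  rw [integral_complex_ofReal, Ne, Complex.ofReal_eq_zero]
  obtain ⟨x, hx⟩ : ∃ x, g x ≠ 0 := by
    by_contra! h
    exact hg (SchwartzMap.ext h)
  have hi : Integrable fun x => ‖g x‖ ^ 2 := by
    simpa using (g.memLp 2).integrable_norm_pow (by norm_num)
  exact (integral_pos_of_integrable_nonneg_nonzero (x := x) (g.continuous.norm.pow 2) hi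
    (fun x => sq_nonneg _) (by simpa using hx)).ne'

/-- Change of window for twisted matrix coefficients. -/
theorem exists_enorm_matrixCoeff_le (hlam : lam ≠ 0) {g : 𝓢(R2 n, ℂ)} (hg : g ≠ 0)
    (g' : 𝓢(R2 n, ℂ)) : ∃ ν : Measure (R2 n × R2 n), IsFiniteMeasure ν ∧
      ∀ (f : 𝓢'(R2 n, ℂ)) (z : R2 n × R2 n), ‖matrixCoeff lam f g' z‖ₑ ≤
        ∫⁻ y, ‖matrixCoeff lam f g (z + y)‖ₑ ∂ν := by
  set m : ℝ≥0∞ := ‖∫ x, g x * conjS g x‖ₑ with hm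
  have hm0 : m ≠ 0 := by simpa [hm] using integral_mul_conjS_ne_zero hg
  have hmtop : m ≠ ∞ := enorm_ne_top
  set κ : R2 n × R2 n → ℝ≥0∞ := fun y => m⁻¹ * ‖SchwartzMap.stft g (conjS g') y.1 y.2‖ₑ with hκ
  have hκm : Measurable κ :=
    measurable_const.mul (SchwartzMap.continuous_stft g (conjS g')).enorm.measurable
  have hκi : ∫⁻ y, κ y ∂(volume.prod volume) ≠ ∞ := by
    rw [hκ, lintegral_const_mul' _ _ (ENNReal.inv_ne_top.mpr hm0)]
    exact ENNReal.mul_ne_top (ENNReal.inv_ne_top.mpr hm0)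
      (SchwartzMap.integrable_stft g (conjS g')).2.ne
  have hBm : Measurable (phaseCoordInv (n := n) lam) := (continuous_phaseCoordInv lam).measurable
  -- Pushing the normalized kernel forward as a measure avoids computing a Jacobian; its mass is
  -- finite because the short-time Fourier transform is integrable.
  refine ⟨(((volume.prod volume : Measure (R2 n × R2 n)).withDensity κ).map (phaseCoordInv lam)),
    ?_, fun f z => ?_⟩
  · have := isFiniteMeasure_withDensity hκi
    infer_instance
  · have hcm : Measurable fun y => ‖matrixCoeff lam f g (z + y)‖ₑ :=
      ((continuous_matrixCoeff f g).comp (continuous_const.add continuous_id)).enorm.measurable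
    rw [lintegral_map hcm hBm, lintegral_withDensity_eq_lintegral_mul _ hκm
      (g := fun a => ‖matrixCoeff lam f g (z + phaseCoordInv lam a)‖ₑ) (hcm.comp hBm)]
    simp only [Pi.mul_apply, enorm_matrixCoeff, phaseCoord_add, phaseCoord_phaseCoordInv hlam, hκ,
      mul_assoc]
    rw [lintegral_const_mul' _ _ (ENNReal.inv_ne_top.mpr hm0)]
    -- Coefficients pair `f` with shifts of conjugated windows, so the windows here are `conjS g`
    -- and `conjS g'`, and `g` itself serves as the dual function `γ`.
    have h1 := SchwartzMap.enorm_apply_timeFreqShift_le f g (conjS g) (conjS g') (phaseCoord lam z)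
    have hinv : ((volume : Measure (R2 n)).prod (volume : Measure (R2 n))).IsAddLeftInvariant :=
      Measure.prod.instIsAddLeftInvariant
    rw [← hm, ← lintegral_add_left_eq_self _ (phaseCoord lam z)] at h1
    simp only [Prod.fst_add, Prod.snd_add, add_sub_cancel_left] at h1
    rw [← one_mul (‖_‖ₑ), ← ENNReal.inv_mul_cancel hm0 hmtop, mul_assoc]
    gcongr
    exact h1

/-- Equivalence of the norms defined by two windows. -/
theorem exists_windowNorm_le (hlam : lam ≠ 0) {p q : ℝ≥0∞} (hp : 1 ≤ p) (hq : 1 ≤ q)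
    {g : 𝓢(R2 n, ℂ)} (hg : g ≠ 0) (g' : 𝓢(R2 n, ℂ)) :
    ∃ C : ℝ≥0, 0 < C ∧ ∀ f : 𝓢'(R2 n, ℂ),
      windowNorm lam p q g' f ≤ C * windowNorm lam p q g f := by
  obtain ⟨ν, hν, h⟩ := exists_enorm_matrixCoeff_le hlam hg g'
  -- The added `1` keeps the constant positive even if `ν` is zero, as happens for `g' = 0`.
  refine ⟨(ν Set.univ).toNNReal + 1, by positivity, fun f => ?_⟩
  have h1 := eLpNorm_eLpNorm_le_of_le_lintegral_add (μ := volume) (ν := ν)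
    (G := fun z => ‖matrixCoeff lam f g z‖ₑ) (H := fun z => ‖matrixCoeff lam f g' z‖ₑ)
    (continuous_matrixCoeff f g).enorm.measurable (h f) hp hq
  have e : ∀ g : 𝓢(R2 n, ℂ), windowNorm lam p q g f = eLpNorm (fun η : R2 n =>
      eLpNorm (fun ξ : R2 n => ‖matrixCoeff lam f g (ξ, η)‖ₑ) p volume) q volume := by
    intro g
    simp only [windowNorm, mixedNorm, eLpNorm_enorm]
  rw [e g', e g]
  refine h1.trans ?_
  gcongr
  rw [ENNReal.coe_add, ENNReal.coe_toNNReal (measure_ne_top ν _)]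
  exact le_self_add

theorem exists_schwartzMap_ne_zero (n : ℕ) : ∃ g : 𝓢(R2 n, ℂ), g ≠ 0 := by
  let b : ContDiffBump (0 : R2 n) := ⟨1, 2, one_pos, one_lt_two⟩
  have hsupp : HasCompactSupport fun x => (b x : ℂ) :=
    b.hasCompactSupport.comp_left (g := Complex.ofReal) Complex.ofReal_zero
  have hsmooth : ContDiff ℝ ((⊤ : ℕ∞) : WithTop ℕ∞) fun x => (b x : ℂ) :=
    Complex.ofRealCLM.contDiff.comp b.contDiff
  refine ⟨hsupp.toSchwartzMap hsmooth, fun h => ?_⟩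
  have h1 : ((b 0 : ℝ) : ℂ) = 0 := congrArg (fun g : 𝓢(R2 n, ℂ) => g 0) h
  rw [b.one_of_mem_closedBall (by simp [b])] at h1
  simp at h1

/-- Coefficients are continuous, so measurability is automatic. -/
theorem memMixed_matrixCoeff_iff {p q : ℝ≥0∞} (f : 𝓢'(R2 n, ℂ)) (g : 𝓢(R2 n, ℂ)) :
    MemMixed p q (matrixCoeff lam f g) ↔ windowNorm lam p q g f < ∞ :=
  and_iff_right (continuous_matrixCoeff f g).aestronglyMeasurable

theorem mem_modulationSpace_iff (hlam : lam ≠ 0) {p q : ℝ≥0∞} (hp : 1 ≤ p) (hq : 1 ≤ q)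
    {g : 𝓢(R2 n, ℂ)} (hg : g ≠ 0) (f : 𝓢'(R2 n, ℂ)) :
    f ∈ modulationSpace n lam p q ↔ windowNorm lam p q g f < ∞ := by
  refine ⟨fun ⟨g₀, hg₀, hf⟩ => ?_, fun hf => ⟨g, hg, (memMixed_matrixCoeff_iff f g).mpr hf⟩⟩
  obtain ⟨C, -, hC⟩ := exists_windowNorm_le hlam hp hq hg₀ g
  exact (hC f).trans_lt (ENNReal.mul_lt_top ENNReal.coe_lt_top
    ((memMixed_matrixCoeff_iff f g₀).mp hf))

theorem measurable_eLpNorm_matrixCoeff (f : 𝓢'(R2 n, ℂ)) (g : 𝓢(R2 n, ℂ)) (p : ℝ≥0∞) :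
    Measurable fun η : R2 n => eLpNorm (fun ξ : R2 n => matrixCoeff lam f g (ξ, η)) p volume := by
  have h := measurable_eLpNorm_section (μ := (volume : Measure (R2 n)))
    (f := fun ξ η => ‖matrixCoeff lam f g (ξ, η)‖ₑ)
    (continuous_matrixCoeff f g).enorm.measurable p
  simpa only [eLpNorm_enorm] using h

theorem windowNorm_smul {p q : ℝ≥0∞} (hq : 1 ≤ q) (g : 𝓢(R2 n, ℂ)) (a : ℂ) (f : 𝓢'(R2 n, ℂ)) :
    windowNorm lam p q g (a • f) = ‖a‖ₑ * windowNorm lam p q g f := by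
  rw [windowNorm, windowNorm, mixedNorm, mixedNorm,
    ← eLpNorm_ennreal_const_mul enorm_ne_top _ (zero_lt_one.trans_le hq).ne']
  congr 1
  funext η
  exact eLpNorm_const_smul a (fun ξ => matrixCoeff lam f g (ξ, η)) p volume

theorem windowNorm_add_le {p q : ℝ≥0∞} (hp : 1 ≤ p) (hq : 1 ≤ q) (g : 𝓢(R2 n, ℂ))
    (f h : 𝓢'(R2 n, ℂ)) :
    windowNorm lam p q g (f + h) ≤ windowNorm lam p q g f + windowNorm lam p q g h := by
  have hc : ∀ (f : 𝓢'(R2 n, ℂ)) (η : R2 n),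
      Continuous fun ξ : R2 n => matrixCoeff lam f g (ξ, η) := fun f η =>
    (continuous_matrixCoeff f g).comp (by fun_prop)
  refine le_trans (eLpNorm_mono_enorm (g := fun η : R2 n =>
    eLpNorm (fun ξ : R2 n => matrixCoeff lam f g (ξ, η)) p volume +
      eLpNorm (fun ξ : R2 n => matrixCoeff lam h g (ξ, η)) p volume) fun η => ?_) ?_
  · simp only [enorm_eq_self]
    exact eLpNorm_add_le (hc f η).aestronglyMeasurable (hc h η).aestronglyMeasurable hp
  · exact eLpNorm_add_le (measurable_eLpNorm_matrixCoeff f g p).aestronglyMeasurable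
      (measurable_eLpNorm_matrixCoeff h g p).aestronglyMeasurable hq

/-- Continuity upgrades "almost everywhere" to "everywhere", first in `ξ` for almost every `η`, then
in `η` for each fixed `ξ`. -/
theorem matrixCoeff_eq_zero_of_windowNorm_eq_zero {p q : ℝ≥0∞} (hp : p ≠ 0) (hq : q ≠ 0)
    {f : 𝓢'(R2 n, ℂ)} {g : 𝓢(R2 n, ℂ)} (h : windowNorm lam p q g f = 0) :
    matrixCoeff lam f g = 0 := by
  have hc := continuous_matrixCoeff (lam := lam) f g
  rw [windowNorm, mixedNorm,
    eLpNorm_eq_zero_iff (measurable_eLpNorm_matrixCoeff f g p).aestronglyMeasurable hq] at h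
  have h1 : ∀ ξ : R2 n, (fun η : R2 n => matrixCoeff lam f g (ξ, η)) =ᵐ[volume]
      fun _ => (0 : ℂ) := by
    intro ξ
    filter_upwards [h] with η hη
    have hcη : Continuous fun ξ : R2 n => matrixCoeff lam f g (ξ, η) := hc.comp (by fun_prop)
    rw [Pi.zero_apply, eLpNorm_eq_zero_iff hcη.aestronglyMeasurable hp] at hη
    exact congrFun ((hcη.ae_eq_iff_eq volume continuous_const).mp hη) ξ
  funext ⟨ξ, η⟩
  have hcξ : Continuous fun η : R2 n => matrixCoeff lam f g (ξ, η) := hc.comp (by fun_prop)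
  exact congrFun ((hcξ.ae_eq_iff_eq volume continuous_const).mp (h1 ξ)) η

theorem eq_zero_of_windowNorm_eq_zero (hlam : lam ≠ 0) {p q : ℝ≥0∞} (hp : p ≠ 0) (hq : q ≠ 0)
    {f : 𝓢'(R2 n, ℂ)} {g : 𝓢(R2 n, ℂ)} (hg : g ≠ 0) (h : windowNorm lam p q g f = 0) : f = 0 := by
  ext φ
  -- For the window `conj φ`, the coefficient at the origin has modulus `|f φ|`, and the change of
  -- window bounds it by the integral of a vanishing function.
  obtain ⟨ν, -, hν⟩ := exists_enorm_matrixCoeff_le hlam hg (conjS φ)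
  have h1 := hν f 0
  rw [matrixCoeff_eq_zero_of_windowNorm_eq_zero hp hq h, enorm_matrixCoeff, conjS_conjS] at h1
  have e : SchwartzMap.timeFreqShift (phaseCoord lam (0 : R2 n × R2 n)).1
      (phaseCoord lam (0 : R2 n × R2 n)).2 φ = φ := by
    have h0 : rotJ (0 : R2 n) = 0 := (rotL n).map_zero
    ext x
    simp [SchwartzMap.timeFreqShift_apply, phaseCoord, h0]
  rw [e] at h1
  simpa using h1

end Coefficients

end TwistedModulation

end

/-! ### Independence of the window -/

theorem mainTheorem1 (n : ℕ) (lam : ℝ) (hlam : lam ≠ 0) (p q : ℝ≥0∞) (hp : 1 ≤ p) (hq : 1 ≤ q) :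
    -- membership for one window implies membership for every other window
    (∀ (f : 𝓢'(R2 n, ℂ)) (g g' : 𝓢(R2 n, ℂ)), g ≠ 0 →
      MemMixed p q (matrixCoeff lam f g) → MemMixed p q (matrixCoeff lam f g')) ∧
    -- so that each window defines the same space
    (∀ g : 𝓢(R2 n, ℂ), g ≠ 0 →
      modulationSpace n lam p q = {f | MemMixed p q (matrixCoeff lam f g)}) ∧
    -- this space is a vector space
    ((0 : 𝓢'(R2 n, ℂ)) ∈ modulationSpace n lam p q ∧
      (∀ f ∈ modulationSpace n lam p q, ∀ h ∈ modulationSpace n lam p q,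
        f + h ∈ modulationSpace n lam p q) ∧
      (∀ (a : ℂ), ∀ f ∈ modulationSpace n lam p q, a • f ∈ modulationSpace n lam p q)) ∧
    -- on which each window defines a norm
    (∀ g : 𝓢(R2 n, ℂ), g ≠ 0 →
      (∀ f ∈ modulationSpace n lam p q, windowNorm lam p q g f < ∞) ∧
      (∀ f ∈ modulationSpace n lam p q, windowNorm lam p q g f = 0 ↔ f = 0) ∧
      (∀ (a : ℂ), ∀ f ∈ modulationSpace n lam p q,
        windowNorm lam p q g (a • f) = ‖a‖ₑ * windowNorm lam p q g f) ∧
      (∀ f ∈ modulationSpace n lam p q, ∀ h ∈ modulationSpace n lam p q,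
        windowNorm lam p q g (f + h) ≤ windowNorm lam p q g f + windowNorm lam p q g h)) ∧
    -- and the norms defined by two windows are equivalent
    (∀ g g' : 𝓢(R2 n, ℂ), g ≠ 0 → g' ≠ 0 →
      ∃ c C : ℝ≥0, 0 < c ∧ 0 < C ∧ ∀ f ∈ modulationSpace n lam p q,
        c * windowNorm lam p q g f ≤ windowNorm lam p q g' f ∧
        windowNorm lam p q g' f ≤ C * windowNorm lam p q g f) := by
  have key : ∀ g : 𝓢(R2 n, ℂ), g ≠ 0 → ∀ f : 𝓢'(R2 n, ℂ),
      f ∈ modulationSpace n lam p q ↔ windowNorm lam p q g f < ∞ := fun g hg f =>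
    mem_modulationSpace_iff hlam hp hq hg f
  -- A single fixed window tests membership, so the vector space properties follow from homogeneity
  -- and the triangle inequality of one norm.
  obtain ⟨g₀, hg₀⟩ := exists_schwartzMap_ne_zero n
  refine ⟨fun f g g' hg hf => ?_, fun g hg => ?_, ⟨?_, fun f hf h hh => ?_, fun a f hf => ?_⟩,
    fun g hg => ⟨fun f hf => (key g hg f).mp hf, fun f _ => ⟨fun h => ?_, ?_⟩,
      fun a f _ => windowNorm_smul hq g a f, fun f _ h _ => windowNorm_add_le hp hq g f h⟩,
    fun g g' hg hg' => ?_⟩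
  · obtain ⟨C, -, hC⟩ := exists_windowNorm_le hlam hp hq hg g'
    rw [memMixed_matrixCoeff_iff] at hf ⊢
    exact (hC f).trans_lt (ENNReal.mul_lt_top ENNReal.coe_lt_top hf)
  · ext f
    exact (key g hg f).trans (memMixed_matrixCoeff_iff f g).symm
  · rw [key g₀ hg₀, ← zero_smul ℂ (0 : 𝓢'(R2 n, ℂ)), windowNorm_smul hq]
    simp
  · rw [key g₀ hg₀] at hf hh ⊢
    exact (windowNorm_add_le hp hq g₀ f h).trans_lt (ENNReal.add_lt_top.mpr ⟨hf, hh⟩)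
  · rw [key g₀ hg₀] at hf ⊢
    rw [windowNorm_smul hq]
    exact ENNReal.mul_lt_top enorm_lt_top hf
  · exact eq_zero_of_windowNorm_eq_zero hlam (zero_lt_one.trans_le hp).ne'
      (zero_lt_one.trans_le hq).ne' hg h
  · rintro rfl
    rw [← zero_smul ℂ (0 : 𝓢'(R2 n, ℂ)), windowNorm_smul hq]
    simp
  · obtain ⟨C, hC0, hC⟩ := exists_windowNorm_le hlam hp hq hg g'
    -- The lower bound is the upper bound with the windows exchanged, hence the constant `c⁻¹`.
    obtain ⟨c, hc0, hc⟩ := exists_windowNorm_le hlam hp hq hg' g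
    refine ⟨c⁻¹, C, inv_pos.mpr hc0, hC0, fun f _ => ⟨?_, hC f⟩⟩
    rw [ENNReal.coe_inv hc0.ne']
    exact ENNReal.inv_mul_le_iff (ENNReal.coe_ne_zero.mpr hc0.ne') ENNReal.coe_ne_top |>.mpr (hc f)
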